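/- Let $G$ be a finite connected simple graph with $N\ge 2$ vertices and $E$ edges, let $z(j)$ be the valence of the vertex $j$, and let the edges have a proper coloring $\alpha$ with colors in $\{1,\dots,1+\max_j z(j)\}$. At each vertex $j$ put $2k_j$ Hermitian gamma matrices of size $2^{k_j}\times 2^{k_j}$, $2k_j=z(j)$ or $z(j)+1$ (whichever is even), with $\{\Gamma_j^\mu,\Gamma_j^\nu\}=2\delta_{\mu\nu}$; matrices at different vertices act on different tensor factors. The different colors present at $j$ are carried by different gamma matrices $\Gamma^{\alpha}_j$ at $j$. Put $\Gamma_j^{\rm ch}=i^{k_j}\Gamma_j^1\cdots\Gamma_j^{2k_j}$, $K_{ij}=\Gamma_i^{\alpha(ij)}\Gamma_j^{\alpha(ij)}$, $H=-\sum_{\langle ij\rangle}J_{ij}K_{ij}$ with $J_{ij}$ real, $L_j=\sqrt{\gamma_j}\,\Gamma_j^{\rm ch}$ with $\gamma_j\ge 0$, and $$\mathcal L(\rho)=-i[H,\rho]+\sum_j\big(L_j\rho L_j^\dagger-\tfrac12\{L_j^\dagger L_j,\rho\}\big).$$ For a closed walk $\mathcal C$ in $G$ let $W_{\mathcal C}$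 be the ordered product of the $K_{ij}$ along $\mathcal C$; for a walk $\mathcal P$ from $u$ to $v\ne u$ let $W^{\rm ch}_{\mathcal P}=\Gamma_u^{\rm ch}\big(\prod_{\langle ij\rangle\in\mathcal P}K_{ij}\big)\Gamma_v^{\rm ch}$. (1) Every $W_{\mathcal C}$ is a strong symmetry (a unitary that commutes with $H$ and with all $L_j,L_j^\dagger$) and every open chiral string $W^{\rm ch}_{\mathcal P}$ is a weak symmetry (a unitary $S$ with $\mathcal L(S\rho S^\dagger)=S\mathcal L(\rho)S^\dagger$ for all $\rho$). (2) Let $G$ be cellularly embedded in a closed oriented surface, given by a cyclic order of the edges around each vertex; puncture any set of faces to obtain an oriented surface $S$, whose remaining faces are the plaquettes $p$. Let $F$ be their number, let $b_2=1$ if $S$ is closed and $b_2=0$ otherwise, and let $b_1=\dim H_1(S;\mathbb Z/2)$. Let $W_p$ be the flux $W_{\mathcal C}$ for the boundary walk $\mathcal C$ of $p$ (all oriented consistently with $S$). There are closed walks $\ell_1,\dots,\ell_{b_1}$ in $G$ whose classes form a basis of $H_1(S;\mathbb Z/2)$. For every such choice take the left actions $\rho\mapsto W\rho$ of the $W_{\ell_a}$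 and of the $W_p$ for $F-b_2$ of the plaquettes (all of them, or all but an arbitrary one if $S$ is closed), and the interlayer fluxes $\mathcal W_{\langle ij\rangle}(\rho)=W^{\rm ch}_{\langle ij\rangle}\rho\,(W^{\rm ch}_{\langle ij\rangle})^\dagger$ of all the edges. These superoperators commute with $\mathcal L$ and with each other; they are independent (no product of a nonempty set of distinct ones is a scalar); up to scalars, every $W_{\mathcal C}$ is a product of the chosen $W_p$ and $W_{\ell_a}$, every conjugation $\rho\mapsto W^{\rm ch}_{\mathcal P}\rho (W^{\rm ch}_{\mathcal P})^\dagger$ is a product of interlayer fluxes, and every right action $\rho\mapsto\rho W_{\mathcal C}^\dagger$ is a product of all of these. Their number is $2E-N+1$: $F-b_2+b_1=E-N+1$ strong fluxes and $E$ weak ones. (3) A strong-flux configuration $w$ assigns to each plaquette $p$ and each loop $\ell_a$ a number, $\pm1$ if the boundary walk or loop has even length and $\pm i$ if it has odd length, with $\prod_p w_p=1$ if $S$ is closed. There are $2^{E-N+1}$ of them. For each of them $$P_w=\prod_a\frac{1+\bar w_{\ell_a}W_{\ell_a}}2\prod_p\frac{1+\bar w_pW_p}2$$ is the orthogonal projector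 onto the joint eigenspace $W_p=w_p$, $W_{\ell_a}=w_{\ell_a}$ (all $p$ and $a$), the dimension of which is $\mathcal Z=2^{N-1}\,2^{M}$ with $2M$ the number of vertices of odd valence; in particular $\mathcal Z=2^{N-1}$ if all valences are even. The states $\rho_w=P_w/\mathcal Z$ are pairwise distinct steady states (density matrices with $\mathcal L(\rho_w)=0$), also $\mathcal L(P_w/2^{N-1})=0$, and $\mathcal W_{\langle ij\rangle}(\rho_w)=\rho_w$ for every edge. -/

import Mathlib

open Matrix Finset
open scoped ComplexOrder

noncomputable section

namespace GammaLindblad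

/-! ### Open quantum systems on a finite-dimensional Hilbert space -/

section Open

variable {n : Type*} [Fintype n] [DecidableEq n]

/-- The Lindbladian with Hamiltonian `H` and jump operators `L j`:
`ρ ↦ -i[H, ρ] + ∑ j, (L j ρ (L j)† - (1/2) {(L j)† (L j), ρ})`. -/
def lindbladian {ι : Type*} [Fintype ι] (H : Matrix n n ℂ) (L : ι → Matrix n n ℂ)
    (ρ : Matrix n n ℂ) : Matrix n n ℂ :=
  -Complex.I • (H * ρ - ρ * H) +
    ∑ j, (L j * ρ * (L j)ᴴ - (1 / 2 : ℂ) • ((L j)ᴴ * L j * ρ + ρ * ((L j)ᴴ * L j)))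

/-- A unitary `S` is a strong symmetry if it commutes with `H`, all `L j` and all `(L j)†`. -/
def IsStrongSymmetry {ι : Type*} (H : Matrix n n ℂ) (L : ι → Matrix n n ℂ)
    (S : Matrix n n ℂ) : Prop :=
  S ∈ Matrix.unitaryGroup n ℂ ∧ Commute S H ∧ ∀ j, Commute S (L j) ∧ Commute S (L j)ᴴ

/-- A unitary `S` is a weak symmetry if conjugation by `S` commutes with the Lindbladian. -/
def IsWeakSymmetry {ι : Type*} [Fintype ι] (H : Matrix n n ℂ) (L : ι → Matrix n n ℂ)
    (S : Matrix n n ℂ) : Prop :=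
  S ∈ Matrix.unitaryGroup n ℂ ∧
    ∀ ρ, lindbladian H L (S * ρ * Sᴴ) = S * lindbladian H L ρ * Sᴴ

/-- A steady state: a density matrix annihilated by the Lindbladian. -/
def IsSteadyState {ι : Type*} [Fintype ι] (H : Matrix n n ℂ) (L : ι → Matrix n n ℂ)
    (ρ : Matrix n n ℂ) : Prop :=
  ρ.PosSemidef ∧ ρ.trace = 1 ∧ lindbladian H L ρ = 0

/-- The left action `ρ ↦ S ρ`. -/
def leftAction (S : Matrix n n ℂ) : Module.End ℂ (Matrix n n ℂ) :=
  LinearMap.mulLeft ℂ S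

/-- The right action `ρ ↦ ρ S†`. -/
def rightAction (S : Matrix n n ℂ) : Module.End ℂ (Matrix n n ℂ) :=
  LinearMap.mulRight ℂ Sᴴ

/-- The adjoint action `ρ ↦ S ρ S†`. -/
def adjointAction (S : Matrix n n ℂ) : Module.End ℂ (Matrix n n ℂ) :=
  leftAction S * rightAction S

end Open

/-- The product of the `f i`, `i ∈ T`, in some order (it is only used for commuting factors). -/
def finProd {ι R : Type*} [Monoid R] (T : Finset ι) (f : ι → R) : R :=
  (T.toList.map f).prod

/-- `X` is, up to a scalar, a product of members of the family `Φ`. -/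
def IsGeneratedBy {ι A : Type*} [Ring A] [Algebra ℂ A] (Φ : ι → A) (X : A) : Prop :=
  ∃ (T : Finset ι) (c : ℂ), X = c • finProd T Φ

/-- The members of `Φ` are independent: no product of a nonempty set of them is a scalar. -/
def IsIndependent {ι A : Type*} [Ring A] [Algebra ℂ A] (Φ : ι → A) : Prop :=
  ∀ T : Finset ι, T.Nonempty → ∀ c : ℂ, finProd T Φ ≠ c • (1 : A)

/-! ### Gamma matrices and tensor products -/

/-- `2k` Hermitian gamma matrices of size `2^k × 2^k`. -/
structure GammaMatrices (k : ℕ) where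
  mat : Fin (2 * k) → Matrix (Fin (2 ^ k)) (Fin (2 ^ k)) ℂ
  isHermitian : ∀ μ, (mat μ).IsHermitian
  clifford : ∀ μ ν, mat μ * mat ν + mat ν * mat μ = if μ = ν then 2 else 0

/-- The chiral element `i^k Γ^1 ⋯ Γ^{2k}`. -/
def GammaMatrices.chiral {k : ℕ} (g : GammaMatrices k) : Matrix (Fin (2 ^ k)) (Fin (2 ^ k)) ℂ :=
  Complex.I ^ k • (List.ofFn g.mat).prod

section Tensor

variable {V : Type*} [Fintype V] [DecidableEq V] {d : V → Type*}
  [∀ v, Fintype (d v)] [∀ v, DecidableEq (d v)]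

/-- The tensor (Kronecker) product `⨂ v, M v`. -/
def tensor (M : ∀ v, Matrix (d v) (d v) ℂ) : Matrix (∀ v, d v) (∀ v, d v) ℂ :=
  Matrix.of fun s t => ∏ v, M v (s v) (t v)

/-- The operator `A` acting on site `v` (and as the identity on all the other sites). -/
def siteOp (v : V) (A : Matrix (d v) (d v) ℂ) : Matrix (∀ v, d v) (∀ v, d v) ℂ :=
  tensor (Pi.mulSingle v A)

theorem tensor_mul (M N : ∀ v, Matrix (d v) (d v) ℂ) :
    tensor M * tensor N = tensor (M * N) := by
  ext s t
  simp only [tensor, Matrix.mul_apply, Matrix.of_apply, Pi.mul_apply, ← Finset.prod_mul_distrib]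
  rw [Finset.prod_univ_sum, Fintype.piFinset_univ]

theorem siteOp_commute {v w : V} (h : v ≠ w) (A : Matrix (d v) (d v) ℂ)
    (B : Matrix (d w) (d w) ℂ) : Commute (siteOp v A) (siteOp w B) := by
  have := Pi.mulSingle_commute (f := fun v => Matrix (d v) (d v) ℂ) h A B
  unfold Commute SemiconjBy at *
  rw [siteOp, siteOp, tensor_mul, tensor_mul, this]

end Tensor

/-! ### The gamma-matrix model on a graph -/

variable {V : Type*} [Fintype V] [DecidableEq V]

section Model

variable (G : SimpleGraph V) [DecidableRel G.Adj]

/-- `k = z/2` if the valence `z` of `v` is even, and `k = (z+1)/2` if it is odd. -/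
def halfDim (v : V) : ℕ := (G.degree v + 1) / 2

/-- Basis labels of the Hilbert space `⨂ v, ℂ^(2^k(v))`. -/
abbrev Basis : Type _ := ∀ v : V, Fin (2 ^ halfDim G v)

/-- Operators on the Hilbert space `⨂ v, ℂ^(2^k(v))`. -/
abbrev Op : Type _ := Matrix (Basis G) (Basis G) ℂ

/-- The data of a gamma-matrix Lindbladian on the graph `G`. -/
structure Model where
  /-- the colors of the edges (values outside the edge set are irrelevant) -/
  color : Sym2 V → Fin (G.maxDegree + 1)
  /-- the color rule: edges of the same color do not meet -/
  color_rule : ∀ e ∈ G.edgeSet, ∀ e' ∈ G.edgeSet, e ≠ e' → (∃ v, v ∈ e ∧ v ∈ e') →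
    color e ≠ color e'
  /-- the local gamma matrices at each vertex -/
  gamma : ∀ v, GammaMatrices (halfDim G v)
  /-- which of the `2k` gamma matrices at `v` carries a given color -/
  label : ∀ v, Fin (G.maxDegree + 1) → Fin (2 * halfDim G v)
  /-- different colors present at `v` are carried by different gamma matrices -/
  label_injOn : ∀ v, Set.InjOn (label v) (color '' G.incidenceSet v)
  /-- the couplings `J_ij = J_ji` -/
  coupling : Sym2 V → ℝ
  /-- the on-site dissipation strengths -/
  dissipation : V → ℝ
  dissipation_nonneg : ∀ v, 0 ≤ dissipation v

end Model

namespace Model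

variable {G : SimpleGraph V} [DecidableRel G.Adj] (m : Model G)

/-- The gamma matrix of color `c` at vertex `v`. -/
def Gam (v : V) (c : Fin (G.maxDegree + 1)) : Op G :=
  siteOp v ((m.gamma v).mat (m.label v c))

/-- The chiral element at vertex `v`. -/
def Gch (v : V) : Op G := siteOp v (m.gamma v).chiral

/-- The edge operator `K_ij = Γ_i^α Γ_j^α` with `α` the color of the edge `ij`. -/
def K : Sym2 V → Op G :=
  Sym2.lift ⟨fun i j => m.Gam i (m.color s(i, j)) * m.Gam j (m.color s(i, j)), by
    intro i j
    dsimp only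
    rw [Sym2.eq_swap (a := j)]
    by_cases h : i = j
    · subst h; rfl
    · exact (siteOp_commute h _ _).eq⟩

/-- The Hamiltonian `H = -∑_{⟨ij⟩} J_ij K_ij`. -/
def H : Op G := -∑ e ∈ G.edgeFinset, (m.coupling e : ℂ) • m.K e

/-- The jump operators `L_j = √γ_j Γ_j^ch`. -/
def jump (v : V) : Op G := ((Real.sqrt (m.dissipation v) : ℝ) : ℂ) • m.Gch v

/-- The string `K_{j₁j₂} K_{j₂j₃} ⋯` along a walk; for a closed walk this is the flux `W_C`. -/
def W {u v : V} (p : G.Walk u v) : Op G := (p.edges.map m.K).prod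

/-- The chiral string `Γ_u^ch K ⋯ K Γ_v^ch` along a walk from `u` to `v`. -/
def Wch {u v : V} (p : G.Walk u v) : Op G := m.Gch u * m.W p * m.Gch v

/-- The interlayer flux of an edge, `ρ ↦ W^ch ρ (W^ch)†` for the chiral string of the single
edge `d` (it does not depend on the direction of `d`). -/
def interlayerFlux (d : G.Dart) : Module.End ℂ (Op G) :=
  adjointAction (m.Wch d.adj.toWalk)

end Model

/-! ### Embeddings into oriented surfaces -/

section Surface

variable (G : SimpleGraph V)

/-- A cyclic order of the outgoing darts at each vertex, i.e. a cellular embedding of the connected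
graph `G` into a closed oriented surface (up to equivalence). -/
structure RotationSystem where
  next : Equiv.Perm G.Dart
  next_fst : ∀ d, (next d).fst = d.fst
  next_sameCycle : ∀ d d' : G.Dart, d.fst = d'.fst → next.SameCycle d d'

variable {G}

/-- The permutation of the darts that follows the boundary of a face: reverse the dart and
turn to the next one. -/
def RotationSystem.facePerm (r : RotationSystem G) : Equiv.Perm G.Dart :=
  (Function.Involutive.toPerm SimpleGraph.Dart.symm SimpleGraph.Dart.symm_involutive).trans r.next

theorem RotationSystem.facePerm_fst (r : RotationSystem G) (d : G.Dart) :
    (r.facePerm d).fst = d.snd :=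
  r.next_fst d.symm

/-- The faces of the closed surface: the orbits of `facePerm`. -/
abbrev RotationSystem.Face (r : RotationSystem G) : Type _ :=
  Quotient (Equiv.Perm.SameCycle.setoid r.facePerm)

/-- The walk that follows `n` steps of the face to which `d` belongs, starting with `d`. -/
def RotationSystem.orbitWalk (r : RotationSystem G) :
    (n : ℕ) → (d : G.Dart) → G.Walk d.fst (r.facePerm^[n] d).fst
  | 0, _ => SimpleGraph.Walk.nil
  | n + 1, d => SimpleGraph.Walk.cons d.adj
      ((r.orbitWalk n (r.facePerm d)).copy (r.facePerm_fst d) rfl)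

/-- The closed boundary walk of a face (from some starting point). -/
def RotationSystem.faceWalk (r : RotationSystem G) (f : r.Face) :
    G.Walk f.out.fst f.out.fst :=
  (r.orbitWalk (Function.minimalPeriod r.facePerm f.out) f.out).copy rfl
    (congrArg (fun d : G.Dart => d.fst) (Function.iterate_minimalPeriod))

variable (G)

/-- A graph embedded in a compact oriented surface, possibly with boundary: each face of the
underlying closed surface is either a plaquette (a disc) or has a hole, and there is one boundary
component for each hole. -/
structure SurfaceEmbedding extends RotationSystem G where
  holes : Set toRotationSystem.Face

variable {G}

namespace SurfaceEmbedding

variable (s : SurfaceEmbedding G)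

/-- The elementary plaquettes. -/
abbrev Plaquette : Type _ := {f : s.Face // f ∉ s.holes}

instance [DecidableRel G.Adj] : Fintype s.Plaquette :=
  Fintype.ofFinite _

/-- The second Betti number: `1` for a closed surface and `0` for a surface with boundary. -/
def b₂ : ℕ := by
  classical exact if s.holes = ∅ then 1 else 0

end SurfaceEmbedding

/-- The mod 2 chain of the edges of a walk. -/
def chain {u v : V} (p : G.Walk u v) : G.edgeSet → ZMod 2 :=
  fun e => (p.edges.count (e : Sym2 V) : ZMod 2)

variable (G) in
/-- The boundary map from mod 2 edge chains to mod 2 vertex chains. -/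
def boundary [DecidableRel G.Adj] : (G.edgeSet → ZMod 2) →ₗ[ZMod 2] (V → ZMod 2) where
  toFun x v := ∑ e : G.edgeSet, if v ∈ (e : Sym2 V) then x e else 0
  map_add' x y := by
    ext v
    simp only [Pi.add_apply, ← Finset.sum_add_distrib]
    exact Finset.sum_congr rfl fun e _ => by split_ifs <;> simp
  map_smul' c x := by
    ext v
    simp [Finset.mul_sum]

variable (G) in
/-- The mod 2 cycles. -/
abbrev cycles [DecidableRel G.Adj] : Submodule (ZMod 2) (G.edgeSet → ZMod 2) :=
  LinearMap.ker (boundary G)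

theorem boundary_chain [DecidableRel G.Adj] {u v : V} (p : G.Walk u v) :
    boundary G (chain p) = Pi.single u 1 + Pi.single v 1 := by
  induction p with
  | @nil w =>
    have h0 : chain (SimpleGraph.Walk.nil : G.Walk w w) = 0 := by
      ext e; simp [chain]
    rw [h0, map_zero]
    exact (ZModModule.add_self _).symm
  | @cons u w v h p ih =>
    have hc : chain (SimpleGraph.Walk.cons h p) =
        Pi.single (⟨s(u, w), h⟩ : G.edgeSet) 1 + chain p := by
      ext e
      by_cases he : e = ⟨s(u, w), h⟩
      · subst he; simp [chain, add_comm]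
      · have he' : ¬ s(u, w) = (e : Sym2 V) := fun H => he (Subtype.ext H.symm)
        simp [chain, he, he']
    have hb : boundary G (Pi.single (⟨s(u, w), h⟩ : G.edgeSet) 1) =
        Pi.single u 1 + Pi.single w 1 := by
      ext x
      have hne : u ≠ w := h.ne
      have : boundary G (Pi.single (⟨s(u, w), h⟩ : G.edgeSet) 1) x =
          if x ∈ s(u, w) then 1 else 0 := by
        change (∑ e : G.edgeSet, if x ∈ (e : Sym2 V) then _ else _) = _
        rw [Finset.sum_eq_single ⟨s(u, w), h⟩] <;> simp +contextual
      rw [this]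
      by_cases h1 : x = u
      · subst h1; simp [hne]
      · by_cases h2 : x = w
        · subst h2; simp [h1]
        · simp [h1, h2]
    rw [hc, map_add, hb, ih, add_assoc, ← add_assoc (Pi.single w 1), ZModModule.add_self, zero_add]

theorem chain_mem_cycles [DecidableRel G.Adj] {u : V} (p : G.Walk u u) :
    chain p ∈ cycles G := by
  rw [LinearMap.mem_ker, boundary_chain, ZModModule.add_self]

namespace SurfaceEmbedding

variable [DecidableRel G.Adj] (s : SurfaceEmbedding G)

/-- The mod 2 boundaries: the span of the boundaries of the plaquettes. -/
def boundaries : Submodule (ZMod 2) (G.edgeSet → ZMod 2) :=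
  Submodule.span (ZMod 2) (Set.range fun p : s.Plaquette => chain (s.faceWalk p.1))

/-- The first mod 2 homology of the surface. -/
abbrev H₁ : Type _ := cycles G ⧸ s.boundaries.submoduleOf (cycles G)

/-- The first Betti number of the surface. -/
def b₁ : ℕ := Module.finrank (ZMod 2) s.H₁

/-- The homology class of a closed walk. -/
def homologyClass {u : V} (p : G.Walk u u) : s.H₁ :=
  Submodule.Quotient.mk ⟨chain p, chain_mem_cycles p⟩

/-- A choice of noncontractible loops: `b₁` closed walks on the graph whose homology classes form a
basis of the first homology. -/
structure LoopSystem where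
  base : Fin s.b₁ → V
  loop : ∀ a, G.Walk (base a) (base a)
  linearIndependent : LinearIndependent (ZMod 2) fun a => s.homologyClass (loop a)
  span_eq_top : Submodule.span (ZMod 2) (Set.range fun a => s.homologyClass (loop a)) = ⊤

end SurfaceEmbedding

end Surface

/-! ### Elementary fluxes, flux sectors and steady states -/

section Fluxes

variable {G : SimpleGraph V} [DecidableRel G.Adj] (m : Model G) {s : SurfaceEmbedding G}
  (l : s.LoopSystem)

/-- The strong fluxes through the plaquettes in `Q` and along the noncontractible loops. -/
def strongFlux (Q : Finset s.Plaquette) : {p // p ∈ Q} ⊕ Fin s.b₁ → Op G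
  | Sum.inl p => m.W (s.faceWalk p.1.1)
  | Sum.inr a => m.W (l.loop a)

/-- The elementary fluxes as superoperators: the left actions of the strong fluxes, and the
interlayer fluxes of the edges (`o` is a choice of a direction for each edge). -/
def elementaryFlux (Q : Finset s.Plaquette) (o : G.edgeSet → G.Dart) :
    ({p // p ∈ Q} ⊕ Fin s.b₁) ⊕ G.edgeSet → Module.End ℂ (Op G) :=
  Sum.elim (fun i => leftAction (strongFlux m l Q i)) (fun e => m.interlayerFlux (o e))

/-- The possible eigenvalues of the flux through a closed string of length `n`. -/
def fluxValues (n : ℕ) : Set ℂ :=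
  if Even n then {1, -1} else {Complex.I, -Complex.I}

/-- A strong-flux configuration: a flux value for each plaquette and each noncontractible loop,
with total flux `1` if the surface is closed. -/
structure StrongConfig where
  plaq : s.Plaquette → ℂ
  loop : Fin s.b₁ → ℂ
  plaq_mem : ∀ p, plaq p ∈ fluxValues (s.faceWalk p.1).length
  loop_mem : ∀ a, loop a ∈ fluxValues (l.loop a).length
  total : s.holes = ∅ → ∏ p, plaq p = 1

variable {l}

/-- `P_w = ∏_ℓ (1 + w_ℓ* W_ℓ)/2 ∏_p (1 + w_p* W_p)/2`. The conjugation only matters for the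
imaginary fluxes of strings of odd length; it makes `w` the eigenvalue on the range of `P_w`. -/
def projector (w : StrongConfig l) : Op G :=
  finProd univ (fun a => (1 / 2 : ℂ) • (1 + star (w.loop a) • m.W (l.loop a))) *
    finProd univ (fun p => (1 / 2 : ℂ) • (1 + star (w.plaq p) • m.W (s.faceWalk p.1)))

variable (G) in
/-- The dimension of the flux sectors: `2^(N-1)`, times a factor `2` for each pair of vertices of
odd valence (where one gamma matrix per vertex enters neither `H` nor the fluxes). -/
def sectorDim : ℕ :=
  2 ^ (Fintype.card V - 1) * 2 ^ (#{v : V | Odd (G.degree v)} / 2)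

/-- The projected infinite-temperature state `ρ_w = P_w / 𝒵`. -/
def sectorState (w : StrongConfig l) : Op G :=
  ((sectorDim G : ℂ)⁻¹) • projector m w

end Fluxes

end GammaLindblad

end

noncomputable section

set_option linter.unusedSectionVars false

namespace GammaLindblad

/-! ### Operators that commute up to a sign -/

section Sign

/-- The sign `(-1)^a`. -/
def sgn (a : ZMod 2) : ℂ := if a = 0 then 1 else -1

@[simp] theorem sgn_zero : sgn 0 = 1 := by simp [sgn]

@[simp] theorem sgn_one : sgn 1 = -1 := by simp [sgn]

theorem zmod_two_cases (a : ZMod 2) : a = 0 ∨ a = 1 := by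
  fin_cases a
  · exact Or.inl rfl
  · exact Or.inr rfl

theorem sgn_add (a b : ZMod 2) : sgn (a + b) = sgn a * sgn b := by
  have h : (1 + 1 : ZMod 2) = 0 := rfl
  rcases zmod_two_cases a with rfl | rfl <;> rcases zmod_two_cases b with rfl | rfl <;> simp [h]

@[simp] theorem sgn_mul_self (a : ZMod 2) : sgn a * sgn a = 1 := by
  rcases zmod_two_cases a with rfl | rfl <;> simp

theorem sgn_ne_zero (a : ZMod 2) : sgn a ≠ 0 := fun h => by simpa [h] using sgn_mul_self a

@[simp] theorem star_sgn (a : ZMod 2) : star (sgn a) = sgn a := by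
  rcases zmod_two_cases a with rfl | rfl <;> simp

theorem sgn_natCast (n : ℕ) : sgn n = (-1) ^ n := by
  induction n with
  | zero => simp
  | succ n ih => rw [Nat.cast_succ, sgn_add, ih, sgn_one, pow_succ]

variable {R : Type*} [Ring R] [Algebra ℂ R]

/-- `A` and `B` commute up to the sign `(-1)^a`. -/
def TwComm (a : ZMod 2) (A B : R) : Prop := A * B = sgn a • (B * A)

theorem twComm_zero_iff {A B : R} : TwComm 0 A B ↔ Commute A B := by
  simp [TwComm, Commute, SemiconjBy]

theorem TwComm.symm {a : ZMod 2} {A B : R} (h : TwComm a A B) : TwComm a B A := by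
  unfold TwComm at *
  rw [h, smul_smul, sgn_mul_self, one_smul]

theorem TwComm.mul_left {a b : ZMod 2} {A B C : R} (h : TwComm a A C) (h' : TwComm b B C) :
    TwComm (a + b) (A * B) C := by
  unfold TwComm at *
  rw [mul_assoc, h', mul_smul_comm, ← mul_assoc, h, smul_mul_assoc, smul_smul, mul_assoc,
    sgn_add, mul_comm (sgn a)]

theorem TwComm.mul_right {a b : ZMod 2} {A B C : R} (h : TwComm a A B) (h' : TwComm b A C) :
    TwComm (a + b) A (B * C) :=
  (h.symm.mul_left h'.symm).symm

theorem twComm_one_left (A : R) : TwComm 0 1 A := twComm_zero_iff.2 (Commute.one_left A)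

theorem TwComm.smul_left {a : ZMod 2} {A B : R} (h : TwComm a A B) (c : ℂ) :
    TwComm a (c • A) B := by
  unfold TwComm at *
  rw [smul_mul_assoc, h, mul_smul_comm, smul_comm]

theorem TwComm.list_prod_left {ι : Type*} {l : List ι} {Φ : ι → R} {a : ι → ZMod 2} {B : R}
    (h : ∀ i ∈ l, TwComm (a i) (Φ i) B) : TwComm (l.map a).sum (l.map Φ).prod B := by
  induction l with
  | nil => simpa using twComm_one_left B
  | cons i l ih =>
    rw [List.map_cons, List.map_cons, List.sum_cons, List.prod_cons]
    exact (h i (by simp)).mul_left (ih fun j hj => h j (by simp [hj]))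

theorem TwComm.finProd_left {ι : Type*} {T : Finset ι} {Φ : ι → R} {a : ι → ZMod 2} {B : R}
    (h : ∀ i ∈ T, TwComm (a i) (Φ i) B) : TwComm (∑ i ∈ T, a i) (finProd T Φ) B := by
  rw [← Finset.sum_map_toList]
  exact TwComm.list_prod_left fun i hi => h i (Finset.mem_toList.1 hi)

/-- An invertible element that anticommutes with a nonzero element is not a scalar. -/
theorem TwComm.ne_smul_one {A B : R} (h : TwComm 1 A B) (hA : IsUnit A) (hB : B ≠ 0) (c : ℂ) :
    A ≠ c • (1 : R) := by
  rintro rfl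
  have h1 : (2 * c) • B = 0 := by
    have : c • B = - (c • B) := by simpa [TwComm] using h
    rw [mul_smul, two_smul]
    nth_rewrite 1 [this]
    simp
  rcases smul_eq_zero.1 h1 with h2 | h2
  · have hc : c = 0 := by simpa using h2
    rw [hc, zero_smul, isUnit_zero_iff] at hA
    exact hB (by rw [← one_mul B, ← hA, zero_mul])
  · exact hB h2

theorem list_prod_isUnit {ι : Type*} {M : Type*} [Monoid M] {l : List ι} {Φ : ι → M}
    (h : ∀ i ∈ l, IsUnit (Φ i)) : IsUnit (l.map Φ).prod := by
  induction l with
  | nil => simp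
  | cons i l ih =>
    rw [List.map_cons, List.prod_cons]
    exact (h i (by simp)).mul (ih fun j hj => h j (by simp [hj]))

theorem finProd_isUnit {ι : Type*} {M : Type*} [Monoid M] {T : Finset ι} {Φ : ι → M}
    (h : ∀ i, IsUnit (Φ i)) : IsUnit (finProd T Φ) :=
  list_prod_isUnit fun i _ => h i

theorem list_prod_mul_reverse_prod {M : Type*} [Monoid M] {l : List M} (h : ∀ A ∈ l, A * A = 1) :
    l.prod * l.reverse.prod = 1 := by
  induction l with
  | nil => simp
  | cons A l ih =>
    rw [List.prod_cons, List.reverse_cons, List.prod_append, List.prod_singleton, mul_assoc,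
      ← mul_assoc l.prod, ih fun B hB => h B (by simp [hB]), one_mul, h A (by simp)]

/-- Reversing a product of `n` anticommuting factors gives the sign `(-1)^(n(n-1)/2)`. -/
theorem reverse_prod_of_pairwise_anticomm {l : List R} (h : l.Pairwise (TwComm 1)) :
    l.reverse.prod = sgn (l.length.choose 2 : ℕ) • l.prod := by
  induction l with
  | nil => simp
  | cons A l ih =>
    rw [List.pairwise_cons] at h
    have h1 : TwComm (l.length : ZMod 2) l.prod A := by
      have := TwComm.list_prod_left (l := l) (Φ := id) (a := fun _ => 1) (B := A)
        fun i hi => (h.1 i hi).symm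
      simpa using this
    rw [List.reverse_cons, List.prod_append, ih h.2, List.prod_singleton, List.prod_cons,
      smul_mul_assoc, h1, smul_smul, List.length_cons, Nat.choose_succ_succ' _ 1, Nat.choose_one_right,
      Nat.cast_add, sgn_add, mul_comm]

end Sign

/-! ### Products up to scalars -/

section Scalars

variable {R : Type*} [Ring R] [Algebra ℂ R]

/-- `A` and `B` agree up to a nonzero scalar. -/
def ProjEq (A B : R) : Prop := ∃ c : ℂ, c ≠ 0 ∧ A = c • B

theorem ProjEq.refl (A : R) : ProjEq A A := ⟨1, one_ne_zero, (one_smul _ _).symm⟩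

theorem ProjEq.symm {A B : R} (h : ProjEq A B) : ProjEq B A := by
  obtain ⟨c, hc, rfl⟩ := h
  exact ⟨c⁻¹, inv_ne_zero hc, by rw [smul_smul, inv_mul_cancel₀ hc, one_smul]⟩

theorem ProjEq.trans {A B C : R} (h : ProjEq A B) (h' : ProjEq B C) : ProjEq A C := by
  obtain ⟨c, hc, rfl⟩ := h
  obtain ⟨d, hd, rfl⟩ := h'
  exact ⟨c * d, mul_ne_zero hc hd, smul_smul _ _ _⟩

theorem ProjEq.mul {A B C D : R} (h : ProjEq A B) (h' : ProjEq C D) :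
    ProjEq (A * C) (B * D) := by
  obtain ⟨c, hc, rfl⟩ := h
  obtain ⟨d, hd, rfl⟩ := h'
  exact ⟨c * d, mul_ne_zero hc hd, by rw [smul_mul_smul_comm]⟩

theorem TwComm.projEq {a : ZMod 2} {A B : R} (h : TwComm a A B) : ProjEq (A * B) (B * A) :=
  ⟨sgn a, sgn_ne_zero a, h⟩

/-- A family whose members commute up to scalars and are involutions up to scalars. -/
structure ProjInvolutive {ι : Type*} (Φ : ι → R) : Prop where
  comm : ∀ i j, ProjEq (Φ i * Φ j) (Φ j * Φ i)
  sq : ∀ i, ProjEq (Φ i * Φ i) 1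

namespace ProjInvolutive

variable {ι : Type*} {Φ : ι → R}

theorem list_perm (hΦ : ProjInvolutive Φ) {l l' : List ι} (h : l.Perm l') :
    ProjEq (l.map Φ).prod (l'.map Φ).prod := by
  induction h with
  | nil => exact ProjEq.refl _
  | cons i _ ih => simpa using (ProjEq.refl (Φ i)).mul ih
  | swap i j l =>
    simpa [mul_assoc] using (hΦ.comm j i).mul (ProjEq.refl (l.map Φ).prod)
  | trans _ _ ih ih' => exact ih.trans ih'

theorem mul_finProd [DecidableEq ι] (hΦ : ProjInvolutive Φ) (i : ι) (T : Finset ι) :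
    ProjEq (Φ i * finProd T Φ) (finProd (symmDiff {i} T) Φ) := by
  have key : ∀ S : Finset ι, i ∉ S → ProjEq (Φ i * finProd S Φ) (finProd (insert i S) Φ) :=
    fun S hS => by simpa [finProd] using (hΦ.list_perm (Finset.toList_insert hS)).symm
  by_cases hi : i ∈ T
  · have h1 : symmDiff {i} T = T.erase i := by
      ext j; by_cases h : j = i <;> simp [Finset.mem_symmDiff, h, hi]
    have h2 := key (T.erase i) (by simp)
    rw [Finset.insert_erase hi] at h2
    rw [h1]
    refine ((ProjEq.refl (Φ i)).mul h2.symm).trans ?_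
    rw [← mul_assoc]
    simpa using (hΦ.sq i).mul (ProjEq.refl (finProd (T.erase i) Φ))
  · have h1 : symmDiff {i} T = insert i T := by
      ext j; by_cases h : j = i <;> simp [Finset.mem_symmDiff, h, hi]
    rw [h1]
    exact key T hi

end ProjInvolutive

variable {ι : Type*} [Fintype ι]

/-- The product of the members of `Φ` on which the mod 2 vector `x` does not vanish. -/
def monomial (Φ : ι → R) (x : ι → ZMod 2) : R := finProd {i | x i ≠ 0} Φ

@[simp] theorem monomial_zero (Φ : ι → R) : monomial Φ 0 = 1 := by
  simp [monomial, finProd]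

theorem monomial_single [DecidableEq ι] (Φ : ι → R) (i : ι) : monomial Φ (Pi.single i 1) = Φ i := by
  have : ({j | (Pi.single i 1 : ι → ZMod 2) j ≠ 0} : Finset ι) = {i} := by
    ext j; simp [Pi.single_apply]
  rw [monomial, this, finProd]
  simp

variable {Φ : ι → R}

theorem ProjInvolutive.mul_monomial [DecidableEq ι] (hΦ : ProjInvolutive Φ) (i : ι)
    (x : ι → ZMod 2) : ProjEq (Φ i * monomial Φ x) (monomial Φ (Pi.single i 1 + x)) := by
  have h : ({j | (Pi.single i 1 + x : ι → ZMod 2) j ≠ 0} : Finset ι) =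
      symmDiff {i} ({j | x j ≠ 0} : Finset ι) := by
    ext j
    have h1 : (1 + 1 : ZMod 2) = 0 := rfl
    by_cases hj : j = i
    · subst hj
      rcases zmod_two_cases (x j) with h | h <;> simp [Finset.mem_symmDiff, h, h1]
    · simp [Finset.mem_symmDiff, hj]
  rw [monomial, monomial, h]
  exact hΦ.mul_finProd i _

theorem ProjInvolutive.list_prod [DecidableEq ι] (hΦ : ProjInvolutive Φ) (l : List ι) :
    ProjEq (l.map Φ).prod (monomial Φ (l.map fun i => Pi.single i 1).sum) := by
  induction l with
  | nil => simpa using ProjEq.refl (1 : R)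
  | cons i l ih =>
    simp only [List.map_cons, List.prod_cons, List.sum_cons]
    exact ((ProjEq.refl _).mul ih).trans (hΦ.mul_monomial i _)

theorem sum_single_support [DecidableEq ι] (x : ι → ZMod 2) :
    ∑ i with x i ≠ 0, (Pi.single i 1 : ι → ZMod 2) = x := by
  ext j
  rw [Finset.sum_apply, Finset.sum_filter, Finset.sum_eq_single j]
  · rcases zmod_two_cases (x j) with h | h <;> simp [h]
  · intro i _ hij
    simp [hij.symm]
  · simp

theorem ProjInvolutive.monomial_mul (hΦ : ProjInvolutive Φ) (x y : ι → ZMod 2) :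
    ProjEq (monomial Φ x * monomial Φ y) (monomial Φ (x + y)) := by
  classical
  have h := hΦ.list_prod
    (({i | x i ≠ 0} : Finset ι).toList ++ ({i | y i ≠ 0} : Finset ι).toList)
  rw [List.map_append, List.prod_append, List.map_append, List.sum_append,
    Finset.sum_map_toList, Finset.sum_map_toList, sum_single_support, sum_single_support] at h
  exact h

/-- A product of elements that are monomials up to scalars. -/
theorem ProjInvolutive.list_prod_monomial {κ : Type*} (hΦ : ProjInvolutive Φ) {Ψ : κ → R}
    {x : κ → ι → ZMod 2} (l : List κ) (h : ∀ k ∈ l, ProjEq (Ψ k) (monomial Φ (x k))) :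
    ProjEq (l.map Ψ).prod (monomial Φ (l.map x).sum) := by
  induction l with
  | nil => simpa using ProjEq.refl (1 : R)
  | cons k l ih =>
    simp only [List.map_cons, List.prod_cons, List.sum_cons]
    exact ((h k (by simp)).mul (ih fun j hj => h j (by simp [hj]))).trans (hΦ.monomial_mul _ _)

/-- `X` is, up to a nonzero scalar, a product of members of the family `Φ`. -/
def Generated (Φ : ι → R) (X : R) : Prop := ∃ x : ι → ZMod 2, ProjEq X (monomial Φ x)

theorem Generated.isGeneratedBy {X : R} (h : Generated Φ X) : IsGeneratedBy Φ X := by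
  obtain ⟨x, c, -, h⟩ := h
  exact ⟨_, c, h⟩

theorem generated_one : Generated Φ 1 := ⟨0, by simpa using ProjEq.refl (1 : R)⟩

theorem generated_self (i : ι) : Generated Φ (Φ i) := by
  classical
  exact ⟨Pi.single i 1, by rw [monomial_single]; exact ProjEq.refl _⟩

theorem Generated.of_projEq {X Y : R} (h : Generated Φ Y) (h' : ProjEq X Y) : Generated Φ X := by
  obtain ⟨x, hx⟩ := h
  exact ⟨x, h'.trans hx⟩

theorem ProjInvolutive.generated_mul (hΦ : ProjInvolutive Φ) {X Y : R} (hX : Generated Φ X)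
    (hY : Generated Φ Y) : Generated Φ (X * Y) := by
  obtain ⟨x, hx⟩ := hX
  obtain ⟨y, hy⟩ := hY
  exact ⟨x + y, (hx.mul hy).trans (hΦ.monomial_mul x y)⟩

theorem ProjInvolutive.generated_list_prod {κ : Type*} (hΦ : ProjInvolutive Φ) {Ψ : κ → R}
    {l : List κ} (h : ∀ k ∈ l, Generated Φ (Ψ k)) : Generated Φ (l.map Ψ).prod := by
  induction l with
  | nil => exact generated_one
  | cons k l ih =>
    rw [List.map_cons, List.prod_cons]
    exact hΦ.generated_mul (h k (by simp)) (ih fun j hj => h j (by simp [hj]))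

end Scalars

/-! ### Site operators and chiral elements -/

section Site

variable {V : Type*} [Fintype V] [DecidableEq V] {d : V → Type*}
  [∀ v, Fintype (d v)] [∀ v, DecidableEq (d v)]

theorem tensor_one : tensor (1 : ∀ v, Matrix (d v) (d v) ℂ) = 1 := by
  ext s t
  simp only [tensor, Matrix.of_apply, Pi.one_apply, Matrix.one_apply]
  by_cases h : s = t
  · simp [h]
  · obtain ⟨v, hv⟩ := Function.ne_iff.1 h
    rw [if_neg h]
    exact Finset.prod_eq_zero (Finset.mem_univ v) (if_neg hv)

theorem siteOp_one (v : V) : siteOp v (1 : Matrix (d v) (d v) ℂ) = 1 := by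
  rw [siteOp, Pi.mulSingle_one, tensor_one]

theorem siteOp_mul (v : V) (A B : Matrix (d v) (d v) ℂ) :
    siteOp v A * siteOp v B = siteOp v (A * B) := by
  rw [siteOp, siteOp, tensor_mul, ← Pi.mulSingle_mul, siteOp]

theorem siteOp_conjTranspose (v : V) (A : Matrix (d v) (d v) ℂ) :
    (siteOp v A)ᴴ = siteOp v Aᴴ := by
  ext s t
  simp only [siteOp, tensor, Matrix.conjTranspose_apply, Matrix.of_apply, star_prod]
  refine Finset.prod_congr rfl fun w _ => ?_
  by_cases h : w = v
  · subst h; simp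
  · simp [Pi.mulSingle_eq_of_ne h, Matrix.one_apply, eq_comm, apply_ite]

theorem siteOp_smul (v : V) (c : ℂ) (A : Matrix (d v) (d v) ℂ) :
    siteOp v (c • A) = c • siteOp v A := by
  ext s t
  simp only [siteOp, tensor, Matrix.of_apply, Matrix.smul_apply, smul_eq_mul]
  rw [← Finset.mul_prod_erase _ _ (Finset.mem_univ v),
    ← Finset.mul_prod_erase univ (fun w => (Pi.mulSingle v A : ∀ v, Matrix (d v) (d v) ℂ) w
      (s w) (t w)) (Finset.mem_univ v), ← mul_assoc]
  congr 1
  · simp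
  · refine Finset.prod_congr rfl fun w hw => ?_
    rw [Pi.mulSingle_eq_of_ne (Finset.ne_of_mem_erase hw),
      Pi.mulSingle_eq_of_ne (Finset.ne_of_mem_erase hw)]

theorem siteOp_twComm {v : V} {a : ZMod 2} {A B : Matrix (d v) (d v) ℂ} (h : TwComm a A B) :
    TwComm a (siteOp v A) (siteOp v B) := by
  unfold TwComm at *
  rw [siteOp_mul, siteOp_mul, h, siteOp_smul]

end Site

namespace GammaMatrices

variable {k : ℕ} (g : GammaMatrices k)

theorem mat_mul_self (μ : Fin (2 * k)) : g.mat μ * g.mat μ = 1 := by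
  have h := g.clifford μ μ
  rw [if_pos rfl, ← two_mul] at h
  have : (2 : ℂ) • (g.mat μ * g.mat μ) = (2 : ℂ) • 1 := by
    rw [two_smul, two_smul, ← two_mul, h]; norm_num
  exact smul_right_injective _ two_ne_zero this

theorem mat_twComm (μ ν : Fin (2 * k)) :
    TwComm (if μ = ν then 0 else 1) (g.mat μ) (g.mat ν) := by
  split_ifs with h
  · subst h; exact twComm_zero_iff.2 (Commute.refl _)
  · have := g.clifford μ ν
    rw [if_neg h] at this
    simp [TwComm, eq_neg_of_add_eq_zero_left this]

theorem chiral_twComm_mat (ν : Fin (2 * k)) : TwComm 1 g.chiral (g.mat ν) := by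
  refine TwComm.smul_left ?_ _
  have h := TwComm.list_prod_left (l := List.finRange (2 * k)) (Φ := g.mat)
    (a := fun μ => if μ = ν then 0 else 1) (B := g.mat ν) fun μ _ => g.mat_twComm μ ν
  rw [← List.ofFn_eq_map, ← List.ofFn_eq_map, List.sum_ofFn] at h
  convert h
  have h2 : ∀ μ, (if μ = ν then 0 else 1 : ZMod 2) = 1 - if μ = ν then 1 else 0 := by
    intro μ; split_ifs <;> simp
  simp only [h2, Finset.sum_sub_distrib, Finset.sum_ite_eq', Finset.sum_const, Finset.mem_univ,
    if_true, Finset.card_univ, Fintype.card_fin, nsmul_eq_mul, Nat.cast_mul, mul_one]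
  have h3 : ((2 : ℕ) : ZMod 2) = 0 := rfl
  rw [h3, zero_mul]
  rfl

theorem reverse_prod :
    (List.ofFn g.mat).reverse.prod = (-1 : ℂ) ^ k • (List.ofFn g.mat).prod := by
  rw [reverse_prod_of_pairwise_anticomm, List.length_ofFn, sgn_natCast]
  · congr 1
    rw [Nat.choose_two_right, mul_assoc, Nat.mul_div_cancel_left _ two_pos]
    rcases k with _ | k
    · simp
    · rw [pow_mul', Odd.neg_one_pow ⟨k, by omega⟩]
  · rw [List.pairwise_ofFn]
    intro i j hij
    simpa [hij.ne] using g.mat_twComm i j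

theorem chiral_isHermitian : g.chiral.IsHermitian := by
  unfold Matrix.IsHermitian chiral
  have h : (List.ofFn g.mat).map Matrix.conjTranspose = List.ofFn g.mat := by
    rw [List.map_ofFn]
    congr 1
    funext μ
    exact g.isHermitian μ
  rw [Matrix.conjTranspose_smul, Matrix.conjTranspose_list_prod, h, reverse_prod, smul_smul]
  congr 1
  rw [star_pow, ← mul_pow]
  simp

theorem chiral_mul_self : g.chiral * g.chiral = 1 := by
  have h1 : (List.ofFn g.mat).prod * (List.ofFn g.mat).reverse.prod = 1 :=
    list_prod_mul_reverse_prod fun A hA => by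
      obtain ⟨μ, rfl⟩ := (List.mem_ofFn' _ _).1 hA
      exact g.mat_mul_self μ
  rw [reverse_prod, mul_smul_comm] at h1
  rw [chiral, smul_mul_smul_comm, ← mul_pow, Complex.I_mul_I, h1]

end GammaMatrices

section Actions

variable {n : Type*} [Fintype n] [DecidableEq n]

theorem leftAction_apply (S ρ : Matrix n n ℂ) : leftAction S ρ = S * ρ := rfl

theorem rightAction_apply (S ρ : Matrix n n ℂ) : rightAction S ρ = ρ * Sᴴ := rfl

theorem adjointAction_apply (S ρ : Matrix n n ℂ) : adjointAction S ρ = S * ρ * Sᴴ :=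
  (mul_assoc _ _ _).symm

theorem leftAction_mul (A B : Matrix n n ℂ) :
    leftAction (A * B) = leftAction A * leftAction B :=
  LinearMap.mulLeft_mul ℂ (Matrix n n ℂ) A B

theorem leftAction_one : leftAction (1 : Matrix n n ℂ) = 1 := LinearMap.mulLeft_one _ _

theorem leftAction_smul (c : ℂ) (A : Matrix n n ℂ) : leftAction (c • A) = c • leftAction A := by
  ext1 ρ
  simp [leftAction_apply]

theorem leftAction_projEq {A B : Matrix n n ℂ} (h : ProjEq A B) :
    ProjEq (leftAction A) (leftAction B) := by
  obtain ⟨c, hc, rfl⟩ := h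
  exact ⟨c, hc, leftAction_smul _ _⟩

theorem leftAction_twComm {a : ZMod 2} {A B : Matrix n n ℂ} (h : TwComm a A B) :
    TwComm a (leftAction A) (leftAction B) := by
  unfold TwComm at *
  rw [← leftAction_mul, ← leftAction_mul, h, leftAction_smul]

theorem leftAction_list_prod {ι : Type*} (l : List ι) (f : ι → Matrix n n ℂ) :
    leftAction (l.map f).prod = (l.map fun i => leftAction (f i)).prod := by
  induction l with
  | nil => exact leftAction_one
  | cons i l ih => simp only [List.map_cons, List.prod_cons, leftAction_mul, ih]

theorem leftAction_isUnit {A : Matrix n n ℂ} (h : IsUnit A) : IsUnit (leftAction A) := by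
  obtain ⟨u, rfl⟩ := h
  refine IsUnit.of_mul_eq_one (leftAction (↑u⁻¹ : Matrix n n ℂ)) ?_
  rw [← leftAction_mul, Units.mul_inv, leftAction_one]

theorem rightAction_mul (A B : Matrix n n ℂ) :
    rightAction (A * B) = rightAction A * rightAction B := by
  ext1 ρ
  simp [rightAction_apply, Matrix.mul_assoc]

theorem rightAction_smul (c : ℂ) (A : Matrix n n ℂ) :
    rightAction (c • A) = star c • rightAction A := by
  ext1 ρ
  simp [rightAction_apply]

theorem leftAction_commute_rightAction (A B : Matrix n n ℂ) :
    Commute (leftAction A) (rightAction B) := by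
  ext1 ρ
  simp [leftAction_apply, rightAction_apply, Matrix.mul_assoc]

theorem rightAction_twComm {a : ZMod 2} {A B : Matrix n n ℂ} (h : TwComm a A B) :
    TwComm a (rightAction A) (rightAction B) := by
  unfold TwComm at *
  rw [← rightAction_mul, ← rightAction_mul, h, rightAction_smul, star_sgn]

theorem adjointAction_mul (A B : Matrix n n ℂ) :
    adjointAction (A * B) = adjointAction A * adjointAction B := by
  ext1 ρ
  simp [adjointAction_apply, Matrix.mul_assoc]

theorem adjointAction_one : adjointAction (1 : Matrix n n ℂ) = 1 := by
  ext1 ρ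
  simp [adjointAction_apply]

theorem adjointAction_commute {a : ZMod 2} {A B : Matrix n n ℂ} (h : TwComm a A B) :
    Commute (adjointAction A) (adjointAction B) := by
  have := ((leftAction_twComm h).mul_right (twComm_zero_iff.2
    (leftAction_commute_rightAction A B))).mul_left ((twComm_zero_iff.2
    (leftAction_commute_rightAction B A).symm).mul_right (rightAction_twComm h))
  rw [add_zero, zero_add, CharTwo.add_self_eq_zero] at this
  exact twComm_zero_iff.1 this

theorem adjointAction_isUnit {A : Matrix n n ℂ} (h : IsUnit A) : IsUnit (adjointAction A) := by
  obtain ⟨u, rfl⟩ := h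
  refine IsUnit.of_mul_eq_one (adjointAction (↑u⁻¹ : Matrix n n ℂ)) ?_
  rw [← adjointAction_mul, Units.mul_inv, adjointAction_one]

theorem adjointAction_list_prod {ι : Type*} (l : List ι)
    (f : ι → Matrix n n ℂ) :
    adjointAction (l.map f).prod = (l.map fun i => adjointAction (f i)).prod := by
  induction l with
  | nil => exact adjointAction_one
  | cons i l ih => simp only [List.map_cons, List.prod_cons, adjointAction_mul, ih]

end Actions

section Chains

variable {V : Type*} [Fintype V] [DecidableEq V] {G : SimpleGraph V}

theorem chain_nil (u : V) : chain (SimpleGraph.Walk.nil : G.Walk u u) = 0 := by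
  ext e; simp [chain]

theorem chain_cons {u v w : V} (h : G.Adj u v) (p : G.Walk v w) :
    chain (SimpleGraph.Walk.cons h p) = Pi.single (⟨s(u, v), h⟩ : G.edgeSet) 1 + chain p := by
  ext e
  by_cases he : e = ⟨s(u, v), h⟩
  · subst he; simp [chain, add_comm]
  · have he' : ¬ s(u, v) = (e : Sym2 V) := fun H => he (Subtype.ext H.symm)
    simp [chain, he, he']

theorem chain_append {u v w : V} (p : G.Walk u v) (q : G.Walk v w) :
    chain (p.append q) = chain p + chain q := by
  ext e
  simp [chain, SimpleGraph.Walk.edges_append]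

theorem chain_reverse {u v : V} (p : G.Walk u v) : chain p.reverse = chain p := by
  ext e
  simp [chain, SimpleGraph.Walk.edges_reverse]

/-- The mod 2 incidence number of a vertex and an edge. -/
def inc (v : V) (e : Sym2 V) : ZMod 2 := if v ∈ e then 1 else 0

theorem boundary_apply [DecidableRel G.Adj] (x : G.edgeSet → ZMod 2) (v : V) :
    boundary G x v = ∑ e, x e * inc v e := by
  refine Finset.sum_congr rfl fun e _ => ?_
  simp [inc]

theorem boundary_chain_closed [DecidableRel G.Adj] {u : V} (p : G.Walk u u) (v : V) :
    boundary G (chain p) v = 0 := by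
  rw [LinearMap.mem_ker.1 (chain_mem_cycles p), Pi.zero_apply]

end Chains

namespace Model

variable {V : Type*} [Fintype V] [DecidableEq V] {G : SimpleGraph V} [DecidableRel G.Adj]
  (m : Model G)

theorem Gam_isHermitian (v : V) (c) : (m.Gam v c)ᴴ = m.Gam v c := by
  rw [Gam, siteOp_conjTranspose, (m.gamma v).isHermitian]

theorem Gam_mul_self (v : V) (c) : m.Gam v c * m.Gam v c = 1 := by
  rw [Gam, siteOp_mul, GammaMatrices.mat_mul_self, siteOp_one]

theorem Gch_isHermitian (v : V) : (m.Gch v)ᴴ = m.Gch v := by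
  rw [Gch, siteOp_conjTranspose, (m.gamma v).chiral_isHermitian]

theorem Gch_mul_self (v : V) : m.Gch v * m.Gch v = 1 := by
  rw [Gch, siteOp_mul, GammaMatrices.chiral_mul_self, siteOp_one]

theorem Gch_commute (u v : V) : Commute (m.Gch u) (m.Gch v) := by
  by_cases h : u = v
  · subst h; exact Commute.refl _
  · exact siteOp_commute h _ _

theorem Gch_twComm_Gam (u v : V) (c) :
    TwComm (if u = v then 1 else 0) (m.Gch u) (m.Gam v c) := by
  split_ifs with h
  · subst h; exact siteOp_twComm ((m.gamma u).chiral_twComm_mat _)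
  · exact twComm_zero_iff.2 (siteOp_commute h _ _)

theorem K_mk (u v : V) : m.K s(u, v) = m.Gam u (m.color s(u, v)) * m.Gam v (m.color s(u, v)) :=
  rfl

theorem K_isHermitian (e : Sym2 V) (he : e ∈ G.edgeSet) : (m.K e)ᴴ = m.K e := by
  induction e with | _ u v
  rw [K_mk, Matrix.conjTranspose_mul, Gam_isHermitian, Gam_isHermitian]
  exact siteOp_commute (G.ne_of_adj he).symm _ _

theorem K_mul_self (e : Sym2 V) (he : e ∈ G.edgeSet) : m.K e * m.K e = 1 := by
  nth_rewrite 1 [← m.K_isHermitian e he]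
  induction e with | _ u v
  rw [K_mk, Matrix.conjTranspose_mul, Gam_isHermitian, Gam_isHermitian, mul_assoc, ← mul_assoc _ _
    (m.Gam v _), Gam_mul_self, one_mul, Gam_mul_self]

theorem inc_mk {u v : V} (h : u ≠ v) (w : V) :
    inc w s(u, v) = (if w = u then 1 else 0) + if w = v then 1 else 0 := by
  by_cases h1 : w = u
  · subst h1; simp [inc, h]
  · simp [inc, h1]

theorem K_twComm_Gch (e : Sym2 V) (he : e ∈ G.edgeSet) (v : V) :
    TwComm (inc v e) (m.K e) (m.Gch v) := by
  induction e with | _ a b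
  rw [inc_mk (G.ne_of_adj he)]
  exact ((m.Gch_twComm_Gam v a _).mul_right (m.Gch_twComm_Gam v b _)).symm

theorem Gam_twComm_Gam {e f : Sym2 V} (he : e ∈ G.edgeSet) (hf : f ∈ G.edgeSet) {u v : V}
    (hu : u ∈ e) (hv : v ∈ f) :
    TwComm (if v = u then (if f = e then 0 else 1) else 0)
      (m.Gam v (m.color f)) (m.Gam u (m.color e)) := by
  split_ifs with h1 h2
  · subst h1 h2; exact twComm_zero_iff.2 (Commute.refl _)
  · subst h1
    refine siteOp_twComm ?_
    have := (m.gamma v).mat_twComm (m.label v (m.color f)) (m.label v (m.color e))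
    rwa [if_neg] at this
    intro hl
    exact m.color_rule f hf e he h2 ⟨v, hv, hu⟩
      (m.label_injOn v ⟨f, ⟨hf, hv⟩, rfl⟩ ⟨e, ⟨he, hu⟩, rfl⟩ hl)
  · exact twComm_zero_iff.2 (siteOp_commute h1 _ _)

theorem K_twComm_Gam {e f : Sym2 V} (he : e ∈ G.edgeSet) (hf : f ∈ G.edgeSet) {u : V}
    (hu : u ∈ e) :
    TwComm (inc u f + if f = e then 1 else 0) (m.K f) (m.Gam u (m.color e)) := by
  induction f with | _ a b
  have hab := G.ne_of_adj hf
  have h := (m.Gam_twComm_Gam he hf hu (Sym2.mem_mk_left a b)).mul_left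
    (m.Gam_twComm_Gam he hf hu (Sym2.mem_mk_right a b))
  rw [inc_mk hab, K_mk]
  convert h using 1
  by_cases h2 : s(a, b) = e
  · subst h2
    rcases Sym2.mem_iff.1 hu with rfl | rfl
    · simp only [if_true, if_neg hab, if_neg hab.symm]; rfl
    · simp only [if_true, if_neg hab, if_neg hab.symm]; rfl
  · simp [h2, eq_comm]

theorem K_twComm_K {u v : V} (h : G.Adj u v) {f : Sym2 V} (hf : f ∈ G.edgeSet) :
    TwComm (inc u f + inc v f) (m.K f) (m.K s(u, v)) := by
  have := (m.K_twComm_Gam (e := s(u, v)) h hf (Sym2.mem_mk_left u v)).mul_right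
    (m.K_twComm_Gam (e := s(u, v)) h hf (Sym2.mem_mk_right u v))
  rwa [add_add_add_comm, CharTwo.add_self_eq_zero, add_zero] at this

theorem K_projInvolutive : ProjInvolutive (fun e : G.edgeSet => m.K e) where
  comm := by
    rintro e ⟨f, hf⟩
    induction f with | _ a b
    exact (m.K_twComm_K hf e.2).projEq
  sq e := by
    rw [m.K_mul_self _ e.2]
    exact ProjEq.refl _

/-! #### Strings -/

@[simp] theorem W_nil (u : V) : m.W (SimpleGraph.Walk.nil : G.Walk u u) = 1 := rfl

theorem W_cons {u v w : V} (h : G.Adj u v) (p : G.Walk v w) :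
    m.W (SimpleGraph.Walk.cons h p) = m.K s(u, v) * m.W p := by
  simp [W]

theorem W_append {u v w : V} (p : G.Walk u v) (q : G.Walk v w) :
    m.W (p.append q) = m.W p * m.W q := by
  simp [W, SimpleGraph.Walk.edges_append]

theorem W_conjTranspose {u v : V} (p : G.Walk u v) : (m.W p)ᴴ = m.W p.reverse := by
  rw [W, W, Matrix.conjTranspose_list_prod, SimpleGraph.Walk.edges_reverse, List.map_reverse,
    List.map_map]
  congr 2
  refine List.map_congr_left fun e he => ?_
  exact m.K_isHermitian e (p.edges_subset_edgeSet he)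

theorem W_mul_reverse {u v : V} (p : G.Walk u v) : m.W p * m.W p.reverse = 1 := by
  rw [W, W, SimpleGraph.Walk.edges_reverse, List.map_reverse]
  refine list_prod_mul_reverse_prod fun A hA => ?_
  obtain ⟨e, he, rfl⟩ := List.mem_map.1 hA
  exact m.K_mul_self e (p.edges_subset_edgeSet he)

theorem W_mul_conjTranspose {u v : V} (p : G.Walk u v) : m.W p * (m.W p)ᴴ = 1 := by
  rw [W_conjTranspose, W_mul_reverse]

theorem W_mem_unitaryGroup {u v : V} (p : G.Walk u v) : m.W p ∈ Matrix.unitaryGroup (Basis G) ℂ :=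
  Matrix.mem_unitaryGroup_iff.2 (m.W_mul_conjTranspose p)

theorem W_isUnit {u v : V} (p : G.Walk u v) : IsUnit (m.W p) :=
  IsUnit.of_mul_eq_one _ (m.W_mul_conjTranspose p)

theorem W_twComm {u v : V} (p : G.Walk u v) {B : Op G} {a : G.edgeSet → ZMod 2}
    (h : ∀ e, TwComm (a e) (m.K e) B) : TwComm (∑ e, chain p e * a e) (m.W p) B := by
  induction p with
  | nil => simpa [chain_nil] using twComm_one_left B
  | cons hadj p ih =>
    rw [chain_cons, W_cons]
    simp only [Pi.add_apply, add_mul, Finset.sum_add_distrib]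
    rw [Finset.sum_eq_single (⟨s(_, _), hadj⟩ : G.edgeSet)]
    · rw [Pi.single_eq_same, one_mul]
      exact (h ⟨s(_, _), hadj⟩).mul_left ih
    · intro e _ he
      simp [he]
    · simp

theorem W_twComm_Gch {u v : V} (p : G.Walk u v) (w : V) :
    TwComm (boundary G (chain p) w) (m.W p) (m.Gch w) := by
  rw [boundary_apply]
  exact m.W_twComm p fun e => m.K_twComm_Gch _ e.2 w

theorem W_twComm_K {u v : V} (p : G.Walk u v) {a b : V} (h : G.Adj a b) :
    TwComm (boundary G (chain p) a + boundary G (chain p) b) (m.W p) (m.K s(a, b)) := by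
  rw [boundary_apply, boundary_apply, ← Finset.sum_add_distrib]
  simp only [← mul_add]
  exact m.W_twComm p fun e => m.K_twComm_K h e.2

theorem W_twComm_Gam {u v : V} (p : G.Walk u v) (e : G.edgeSet) {w : V} (hw : w ∈ (e : Sym2 V)) :
    TwComm (boundary G (chain p) w + chain p e) (m.W p) (m.Gam w (m.color e)) := by
  convert m.W_twComm p fun f => m.K_twComm_Gam e.2 f.2 hw using 1
  simp only [mul_add, Finset.sum_add_distrib, boundary_apply]
  congr 1
  rw [Finset.sum_eq_single e] <;> simp +contextual [Subtype.ext_iff]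

section Closed

variable {u : V} (C : G.Walk u u)

theorem W_commute_Gch (w : V) : Commute (m.W C) (m.Gch w) := by
  have := m.W_twComm_Gch C w
  rwa [boundary_chain_closed, twComm_zero_iff] at this

theorem W_commute_K {e : Sym2 V} (he : e ∈ G.edgeSet) : Commute (m.W C) (m.K e) := by
  induction e with | _ a b
  have := m.W_twComm_K C he
  rwa [boundary_chain_closed, boundary_chain_closed, add_zero, twComm_zero_iff] at this

theorem W_closed_twComm_Gam (e : G.edgeSet) {w : V} (hw : w ∈ (e : Sym2 V)) :
    TwComm (chain C e) (m.W C) (m.Gam w (m.color e)) := by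
  have := m.W_twComm_Gam C e hw
  rwa [boundary_chain_closed, zero_add] at this

theorem W_commute_W {a b : V} (p : G.Walk a b) : Commute (m.W C) (m.W p) := by
  refine Commute.list_prod_right _ _ fun A hA => ?_
  obtain ⟨e, he, rfl⟩ := List.mem_map.1 hA
  exact m.W_commute_K C (p.edges_subset_edgeSet he)

theorem W_commute_Wch {a b : V} (p : G.Walk a b) : Commute (m.W C) (m.Wch p) :=
  ((m.W_commute_Gch C a).mul_right (m.W_commute_W C p)).mul_right (m.W_commute_Gch C b)

theorem commute_H {A : Op G} (h : ∀ e ∈ G.edgeSet, Commute A (m.K e)) : Commute A m.H := by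
  rw [H]
  refine (Commute.sum_right _ _ _ fun e he => ?_).neg_right
  exact (h e (SimpleGraph.mem_edgeFinset.1 he)).smul_right _

theorem jump_isHermitian (v : V) : (m.jump v)ᴴ = m.jump v := by
  rw [jump, Matrix.conjTranspose_smul, Gch_isHermitian]
  simp

theorem W_isStrongSymmetry : IsStrongSymmetry m.H m.jump (m.W C) := by
  refine ⟨m.W_mem_unitaryGroup C, m.commute_H fun e he => m.W_commute_K C he, fun j => ?_⟩
  rw [jump_isHermitian, and_self]
  exact (m.W_commute_Gch C j).smul_right _

end Closed

/-! The sign of a reversed string. -/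

theorem W_reverse_eq {u v : V} (p : G.Walk u v) :
    m.W p.reverse = sgn (p.length + if u = v then 0 else 1) • m.W p := by
  induction p with
  | nil => simp
  | @cons u w v h p ih =>
    have hne := h.ne
    have hs := m.W_twComm_K p h
    rw [boundary_chain] at hs
    rw [SimpleGraph.Walk.reverse_cons, W_append, ih, W_cons, W_cons, W_nil, mul_one,
      smul_mul_assoc, Sym2.eq_swap (a := w), hs, smul_smul, ← sgn_add, SimpleGraph.Walk.length_cons, Nat.cast_add]
    congr 2
    have h2 : (1 + 1 : ZMod 2) = 0 := rfl
    by_cases h1 : w = v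
    · subst h1
      simp [hne, add_assoc, h2]
    · by_cases h3 : u = v
      · subst h3
        simp [h1, hne, h2]
      · simp [h1, h3, hne, add_assoc, h2]

theorem W_conjTranspose_closed {u : V} (C : G.Walk u u) :
    (m.W C)ᴴ = (-1 : ℂ) ^ C.length • m.W C := by
  rw [W_conjTranspose, W_reverse_eq, if_pos rfl, add_zero, sgn_natCast]

theorem W_mul_self_closed {u : V} (C : G.Walk u u) :
    m.W C * m.W C = (-1 : ℂ) ^ C.length • 1 := by
  have h := m.W_mul_conjTranspose C
  rw [W_conjTranspose_closed, mul_smul_comm] at h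
  rw [← h, smul_smul, ← mul_pow]
  simp

/-! #### Chiral strings -/

section Chiral

variable {u v : V} (p : G.Walk u v)

theorem Wch_conjTranspose : (m.Wch p)ᴴ = m.Gch v * (m.W p)ᴴ * m.Gch u := by
  rw [Wch, Matrix.conjTranspose_mul, Matrix.conjTranspose_mul, Gch_isHermitian, Gch_isHermitian,
    mul_assoc]

theorem Wch_mul_conjTranspose : m.Wch p * (m.Wch p)ᴴ = 1 := by
  rw [Wch_conjTranspose, Wch, mul_assoc, ← mul_assoc (m.Gch v), ← mul_assoc (m.Gch v),
    Gch_mul_self, one_mul, mul_assoc, ← mul_assoc (m.W p), W_mul_conjTranspose, one_mul,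
    Gch_mul_self]

theorem Wch_isUnit : IsUnit (m.Wch p) := IsUnit.of_mul_eq_one _ (m.Wch_mul_conjTranspose p)

theorem Gch_twComm_K (e : Sym2 V) (he : e ∈ G.edgeSet) : TwComm (inc v e) (m.Gch v) (m.K e) :=
  (m.K_twComm_Gch e he v).symm

theorem Wch_commute_K {e : Sym2 V} (he : e ∈ G.edgeSet) : Commute (m.Wch p) (m.K e) := by
  have h1 := m.Gch_twComm_K (v := u) e he
  have h2 := m.Gch_twComm_K (v := v) e he
  induction e with | _ a b
  have := (h1.mul_left (m.W_twComm_K p he)).mul_left h2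
  rw [← twComm_zero_iff, Wch]
  convert this using 1
  rw [boundary_chain, inc_mk (G.ne_of_adj he), inc_mk (G.ne_of_adj he)]
  simp only [Pi.add_apply, Pi.single_apply, eq_comm (a := a), eq_comm (a := b)]
  generalize (if u = a then 1 else 0 : ZMod 2) = x1
  generalize (if u = b then 1 else 0 : ZMod 2) = x2
  generalize (if v = a then 1 else 0 : ZMod 2) = x3
  generalize (if v = b then 1 else 0 : ZMod 2) = x4
  revert x1 x2 x3 x4
  decide

theorem Wch_twComm_Gch (w : V) : TwComm (boundary G (chain p) w) (m.Wch p) (m.Gch w) := by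
  have := ((twComm_zero_iff.2 (m.Gch_commute u w)).mul_left (m.W_twComm_Gch p w)).mul_left
    (twComm_zero_iff.2 (m.Gch_commute v w))
  rwa [zero_add, add_zero] at this

end Chiral

end Model

section WeakSymmetry

variable {n : Type*} [Fintype n] [DecidableEq n] {ι : Type*} [Fintype ι]

/-- A unitary that commutes with `H` and commutes up to signs with the Hermitian jump operators
is a weak symmetry. -/
theorem isWeakSymmetry_of_twComm {H : Matrix n n ℂ} {L : ι → Matrix n n ℂ} {S : Matrix n n ℂ}
    (hS : S * Sᴴ = 1) (hL : ∀ j, (L j)ᴴ = L j) (hH : Commute S H) {a : ι → ZMod 2}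
    (hSL : ∀ j, TwComm (a j) S (L j)) : IsWeakSymmetry H L S := by
  have hS' : Sᴴ * S = 1 := mul_eq_one_comm.1 hS
  have dag : ∀ {b : ZMod 2} {A : Matrix n n ℂ}, TwComm b S A → TwComm b Sᴴ A := by
    intro b A h
    have h1 : Sᴴ * (A * S) * Sᴴ = sgn b • (Sᴴ * (S * A) * Sᴴ) := by
      rw [h.symm, mul_smul_comm, smul_mul_assoc]
    unfold TwComm
    rwa [mul_assoc, mul_assoc A, hS, mul_one, ← mul_assoc, hS', one_mul] at h1
  refine ⟨Matrix.mem_unitaryGroup_iff.2 hS, fun ρ => ?_⟩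
  have hH' : Commute Sᴴ H := twComm_zero_iff.1 (dag (twComm_zero_iff.2 hH))
  have sq : ∀ j, Commute S (L j * L j) := fun j => by
    have := (hSL j).mul_right (hSL j)
    rwa [CharTwo.add_self_eq_zero, twComm_zero_iff] at this
  have sq' : ∀ j, Commute Sᴴ (L j * L j) := fun j =>
    twComm_zero_iff.1 (dag (twComm_zero_iff.2 (sq j)))
  have left : ∀ A : Matrix n n ℂ, Commute S A → A * (S * ρ * Sᴴ) = S * (A * ρ) * Sᴴ := by
    intro A h
    rw [← mul_assoc, ← mul_assoc, ← h.eq, mul_assoc S]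
  have right : ∀ A : Matrix n n ℂ, Commute Sᴴ A → S * ρ * Sᴴ * A = S * (ρ * A) * Sᴴ := by
    intro A h
    rw [mul_assoc, h.eq, ← mul_assoc, mul_assoc S]
  have mid : ∀ j, L j * (S * ρ * Sᴴ) * L j = S * (L j * ρ * L j) * Sᴴ := by
    intro j
    calc L j * (S * ρ * Sᴴ) * L j = (L j * S) * ρ * (Sᴴ * L j) := by simp only [mul_assoc]
      _ = S * (L j * ρ * L j) * Sᴴ := by
        rw [dag (hSL j), (hSL j).symm, smul_mul_assoc, smul_mul_assoc, mul_smul_comm, smul_smul,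
          sgn_mul_self, one_smul]
        simp only [mul_assoc]
  simp only [lindbladian, hL, mid, left _ hH, right _ hH', left _ (sq _), right _ (sq' _),
    Matrix.mul_add, Matrix.add_mul, Matrix.mul_sub, Matrix.sub_mul, Matrix.mul_smul,
    Matrix.smul_mul, Matrix.mul_sum, Matrix.sum_mul]

/-- The left action of a strong symmetry commutes with the Lindbladian. -/
theorem IsStrongSymmetry.lindbladian_mul {H : Matrix n n ℂ} {L : ι → Matrix n n ℂ}
    {S : Matrix n n ℂ} (h : IsStrongSymmetry H L S) (ρ : Matrix n n ℂ) :
    lindbladian H L (S * ρ) = S * lindbladian H L ρ := by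
  obtain ⟨-, hH, hL⟩ := h
  have left : ∀ A : Matrix n n ℂ, Commute S A → A * (S * ρ) = S * (A * ρ) := by
    intro A h
    rw [← mul_assoc, ← h.eq, mul_assoc]
  have hLL : ∀ j, Commute S ((L j)ᴴ * L j) := fun j => (hL j).2.mul_right (hL j).1
  simp only [lindbladian, left _ hH, left _ (hL _).1, left _ (hLL _), Matrix.mul_add,
    Matrix.mul_sub, Matrix.mul_smul, Matrix.mul_sum, mul_assoc]

/-- An operator that commutes with the Hamiltonian and with the Hermitian jump operators is
annihilated by the Lindbladian. -/
theorem lindbladian_eq_zero {H : Matrix n n ℂ} {L : ι → Matrix n n ℂ} {A : Matrix n n ℂ}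
    (hL : ∀ j, (L j)ᴴ = L j) (hH : Commute A H) (hAL : ∀ j, Commute A (L j)) :
    lindbladian H L A = 0 := by
  have h1 : ∀ j, L j * A * L j = L j * L j * A := fun j => by
    rw [mul_assoc, (hAL j).eq, mul_assoc]
  have h2 : ∀ j, A * (L j * L j) = L j * L j * A := fun j => ((hAL j).mul_right (hAL j)).eq
  have h3 : ∀ B : Matrix n n ℂ, B - (1 / 2 : ℂ) • (B + B) = 0 := fun B => by
    rw [← two_smul ℂ B, smul_smul]; norm_num
  simp only [lindbladian, hL, h1, h2, h3, hH.eq, sub_self, smul_zero, Finset.sum_const_zero,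
    add_zero]

end WeakSymmetry

namespace Model

variable {V : Type*} [Fintype V] [DecidableEq V] {G : SimpleGraph V} [DecidableRel G.Adj]
  (m : Model G)

theorem Wch_isWeakSymmetry {u v : V} (p : G.Walk u v) :
    IsWeakSymmetry m.H m.jump (m.Wch p) :=
  isWeakSymmetry_of_twComm (m.Wch_mul_conjTranspose p) m.jump_isHermitian
    (m.commute_H fun _ he => m.Wch_commute_K p he)
    fun j => ((m.Wch_twComm_Gch p j).symm.smul_left _).symm

/-! #### Interlayer fluxes -/

theorem Wch_edge {u v : V} (h : G.Adj u v) :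
    m.Wch h.toWalk = m.Gch u * m.K s(u, v) * m.Gch v := by
  rw [Wch, SimpleGraph.Adj.toWalk, W_cons, W_nil, mul_one]

theorem Wch_edge_symm {u v : V} (h : G.Adj u v) : m.Wch h.symm.toWalk = m.Wch h.toWalk := by
  have h1 := (twComm_zero_iff.2 (m.Gch_commute u v)).mul_right (m.Gch_twComm_K (v := u) s(u, v) h)
  have h2 := m.Gch_twComm_K (v := v) s(u, v) h
  rw [show inc u s(u, v) = 1 by simp [inc]] at h1
  rw [show inc v s(u, v) = 1 by simp [inc]] at h2
  have h3 : m.Gch v * m.K s(u, v) = -(m.K s(u, v) * m.Gch v) := by simpa [TwComm] using h2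
  rw [zero_add, h3] at h1
  have h4 : -(m.Gch u * (m.K s(u, v) * m.Gch v)) = m.K s(u, v) * m.Gch v * m.Gch u := by
    simpa [TwComm] using h1
  rw [Wch_edge, Wch_edge, Sym2.eq_swap, h3, neg_mul, ← h4, neg_neg, mul_assoc]

theorem interlayerFlux_congr {d d' : G.Dart} (h : d.edge = d'.edge) :
    m.interlayerFlux d = m.interlayerFlux d' := by
  rcases SimpleGraph.dart_edge_eq_iff d d' |>.1 h with rfl | rfl
  · rfl
  · exact congrArg adjointAction (m.Wch_edge_symm d'.adj)

/-- A chiral string is the product of the chiral strings of its edges. -/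
theorem Wch_eq_prod {u v : V} (p : G.Walk u v) :
    m.Wch p = (p.darts.map fun d => m.Wch d.adj.toWalk).prod := by
  induction p with
  | nil => simp [Wch, Gch_mul_self]
  | @cons u w v h p ih =>
    rw [SimpleGraph.Walk.darts_cons, List.map_cons, List.prod_cons, ← ih, Wch_edge, Wch, Wch,
      W_cons, mul_assoc _ (m.Gch w), mul_assoc (m.Gch w), ← mul_assoc (m.Gch w), Gch_mul_self,
      one_mul]
    simp only [mul_assoc]

theorem Wch_edge_twComm_Gam {f : Sym2 V} {u v w : V} (h : G.Adj u v) (hf : f ∈ G.edgeSet)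
    (hw : w ∈ f) : TwComm (if s(u, v) = f then 1 else 0) (m.Wch h.toWalk) (m.Gam w (m.color f)) := by
  have := ((m.Gch_twComm_Gam u w (m.color f)).mul_left (m.K_twComm_Gam hf (f := s(u, v)) h hw)).mul_left
    (m.Gch_twComm_Gam v w (m.color f))
  rw [Wch_edge]
  convert this using 1
  rw [inc_mk h.ne]
  simp only [eq_comm (a := w)]
  generalize (if u = w then 1 else 0 : ZMod 2) = x1
  generalize (if v = w then 1 else 0 : ZMod 2) = x2
  generalize (if s(u, v) = f then 1 else 0 : ZMod 2) = x3
  revert x1 x2 x3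
  decide

theorem Wch_twComm_Wch {a b u v : V} (p : G.Walk a b) (q : G.Walk u v) :
    TwComm (boundary G (chain p) u + boundary G (chain p) v) (m.Wch p) (m.Wch q) := by
  have hW : Commute (m.Wch p) (m.W q) := by
    refine Commute.list_prod_right _ _ fun A hA => ?_
    obtain ⟨e, he, rfl⟩ := List.mem_map.1 hA
    exact m.Wch_commute_K p (q.edges_subset_edgeSet he)
  have := ((m.Wch_twComm_Gch p u).mul_right (twComm_zero_iff.2 hW)).mul_right (m.Wch_twComm_Gch p v)
  rwa [add_zero] at this

theorem Wch_mul_self {u v : V} (h : G.Adj u v) : m.Wch h.toWalk * m.Wch h.toWalk = 1 := by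
  have h1 := m.Wch_mul_conjTranspose h.toWalk
  have h2 : (m.Wch h.toWalk)ᴴ = m.Wch h.toWalk := by
    rw [← m.Wch_edge_symm h, Wch_conjTranspose, m.Wch_edge_symm h, Wch_edge, SimpleGraph.Adj.toWalk,
      W_cons, W_nil, mul_one, m.K_isHermitian _ h.symm, Sym2.eq_swap]
  rwa [h2] at h1

theorem interlayerFlux_mul_self (d : G.Dart) : m.interlayerFlux d * m.interlayerFlux d = 1 := by
  rw [interlayerFlux, ← adjointAction_mul, Wch_mul_self, adjointAction_one]

theorem interlayerFlux_commute (d d' : G.Dart) :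
    Commute (m.interlayerFlux d) (m.interlayerFlux d') :=
  adjointAction_commute (m.Wch_twComm_Wch _ _)

theorem interlayerFlux_isUnit (d : G.Dart) : IsUnit (m.interlayerFlux d) :=
  adjointAction_isUnit (m.Wch_isUnit _)

end Model

section

variable {V : Type*} [Fintype V] [DecidableEq V] {G : SimpleGraph V}

/-! ### The cycle space -/

/-- The edge of a dart, as a member of the edge set. -/
def dartEdge (d : G.Dart) : G.edgeSet := ⟨d.edge, d.edge_mem⟩

theorem chain_eq_sum {u v : V} (p : G.Walk u v) :
    chain p = (p.darts.map fun d => (Pi.single (dartEdge d) 1 : G.edgeSet → ZMod 2)).sum := by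
  induction p with
  | nil => exact chain_nil _
  | cons h p ih => rw [chain_cons, ih]; rfl

section CycleSpace

theorem sum_inc_smul {M : Type*} [AddCommGroup M] [Module (ZMod 2) M] {a b : V} (h : a ≠ b)
    (y : V → M) : ∑ v, inc v s(a, b) • y v = y a + y b := by
  simp only [Model.inc_mk h, add_smul, Finset.sum_add_distrib, ite_smul, one_smul, zero_smul]
  simp

theorem exists_closed_walk {r : V} (P : ∀ v, G.Walk r v) (e : G.edgeSet) :
    ∃ C : G.Walk r r, chain C = Pi.single e 1 + ∑ v, inc v e • chain (P v) := by
  obtain ⟨e, he⟩ := e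
  induction e with | _ a b
  have hab : G.Adj a b := he
  refine ⟨(P a).append (SimpleGraph.Walk.cons hab (P b).reverse), ?_⟩
  rw [sum_inc_smul hab.ne, chain_append, chain_cons, chain_reverse]
  abel

variable [DecidableRel G.Adj]

theorem sum_smul_single (x : G.edgeSet → ZMod 2) :
    ∑ e, x e • (Pi.single e 1 : G.edgeSet → ZMod 2) = x := by
  ext f
  simp [Finset.sum_apply, Pi.single_apply]

/-- The cycles of a connected graph are spanned by closed walks. -/
theorem cycles_le_span (hG : G.Connected) :
    cycles G ≤ Submodule.span (ZMod 2)
      (Set.range fun C : Σ u, G.Walk u u => chain C.2) := by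
  intro x hx
  obtain ⟨r⟩ := hG.nonempty
  let P : ∀ v, G.Walk r v := fun v => (hG.preconnected r v).some
  choose C hC using exists_closed_walk P
  have hx' : x = ∑ e, x e • chain (C e) := by
    simp only [hC, smul_add, Finset.sum_add_distrib, sum_smul_single, Finset.smul_sum, smul_smul]
    rw [Finset.sum_comm]
    simp only [← Finset.sum_smul, ← boundary_apply, LinearMap.mem_ker.1 hx]
    simp
  rw [hx']
  exact Submodule.sum_mem _ fun e _ => Submodule.smul_mem _ _ (Submodule.subset_span ⟨⟨r, C e⟩, rfl⟩)

theorem range_boundary (hG : G.Connected) :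
    LinearMap.range (boundary G) =
      LinearMap.ker (∑ v : V, LinearMap.proj v : (V → ZMod 2) →ₗ[ZMod 2] ZMod 2) := by
  ext y
  rw [LinearMap.mem_ker, LinearMap.sum_apply]
  simp only [LinearMap.proj_apply]
  constructor
  · rintro ⟨x, rfl⟩
    simp only [boundary_apply]
    rw [Finset.sum_comm]
    refine Finset.sum_eq_zero fun e _ => ?_
    obtain ⟨e, he⟩ := e
    induction e with | _ a b
    have hab : G.Adj a b := he
    have := sum_inc_smul hab.ne fun _ => (1 : ZMod 2)
    simp only [smul_eq_mul, mul_one] at this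
    rw [← Finset.mul_sum, this, CharTwo.add_self_eq_zero, mul_zero]
  · intro hy
    obtain ⟨r⟩ := hG.nonempty
    refine ⟨∑ v, y v • chain (hG.preconnected r v).some, ?_⟩
    simp only [map_sum, map_smul, boundary_chain, smul_add, Finset.sum_add_distrib,
      ← Finset.sum_smul, hy, zero_smul, zero_add]
    ext w
    simp [Finset.sum_apply, Pi.single_apply]

theorem finrank_cycles (hG : G.Connected) :
    Module.finrank (ZMod 2) (cycles G) + Fintype.card V = Fintype.card G.edgeSet + 1 := by
  have h1 := LinearMap.finrank_range_add_finrank_ker (boundary G)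
  have h2 := LinearMap.finrank_range_add_finrank_ker
    (∑ v : V, LinearMap.proj v : (V → ZMod 2) →ₗ[ZMod 2] ZMod 2)
  have h3 : LinearMap.range (∑ v : V, LinearMap.proj v : (V → ZMod 2) →ₗ[ZMod 2] ZMod 2) = ⊤ := by
    obtain ⟨r⟩ := hG.nonempty
    refine LinearMap.range_eq_top.2 fun c => ⟨Pi.single r c, ?_⟩
    simp [LinearMap.sum_apply]
  rw [range_boundary hG, Module.finrank_fintype_fun_eq_card] at h1
  rw [h3, finrank_top, Module.finrank_self, Module.finrank_fintype_fun_eq_card] at h2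
  change Module.finrank (ZMod 2) (LinearMap.ker (boundary G)) + _ = _
  omega

end CycleSpace

/-! ### Faces -/

namespace RotationSystem

variable (r : RotationSystem G)

theorem orbitWalk_darts (n : ℕ) (d : G.Dart) :
    (r.orbitWalk n d).darts = (List.range n).map fun i => r.facePerm^[i] d := by
  induction n generalizing d with
  | zero => rfl
  | succ n ih =>
    have h : (r.orbitWalk (n + 1) d).darts = d :: (r.orbitWalk n (r.facePerm d)).darts :=
      congrArg (d :: ·) (SimpleGraph.Walk.darts_copy (r.orbitWalk n (r.facePerm d)) _ _)
    rw [h, ih, List.range_succ_eq_map, List.map_cons, List.map_map]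
    rfl

theorem faceWalk_darts (f : r.Face) : (r.faceWalk f).darts =
    (List.range (Function.minimalPeriod r.facePerm f.out)).map fun i => r.facePerm^[i] f.out := by
  rw [faceWalk, SimpleGraph.Walk.darts_copy, orbitWalk_darts]

/-- The face to the side of a dart. -/
def face (d : G.Dart) : r.Face := Quotient.mk _ d

theorem face_eq_iff {d d' : G.Dart} : r.face d = r.face d' ↔ r.facePerm.SameCycle d d' :=
  Quotient.eq (r := Equiv.Perm.SameCycle.setoid r.facePerm)

theorem face_facePerm (d : G.Dart) : r.face (r.facePerm d) = r.face d :=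
  r.face_eq_iff.2 (Equiv.Perm.sameCycle_apply_left.2 (Equiv.Perm.SameCycle.refl _ _))

theorem face_out (f : r.Face) : r.face f.out = f := Quotient.out_eq f

variable [DecidableRel G.Adj]

theorem faceWalk_darts_nodup (f : r.Face) : (r.faceWalk f).darts.Nodup := by
  rw [faceWalk_darts]
  exact Cycle.nodup_coe_iff.1 Function.nodup_periodicOrbit

theorem mem_faceWalk_darts (f : r.Face) (d : G.Dart) :
    d ∈ (r.faceWalk f).darts ↔ r.face d = f := by
  have hp : f.out ∈ Function.periodicPts r.facePerm :=
    r.facePerm.injective.mem_periodicPts f.out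
  rw [faceWalk_darts, ← Cycle.mem_coe_iff]
  refine (Function.mem_periodicOrbit_iff hp).trans ?_
  nth_rewrite 2 [← r.face_out f]
  rw [face_eq_iff, Equiv.Perm.sameCycle_comm]
  constructor
  · rintro ⟨n, hn⟩
    exact ⟨n, by rw [zpow_natCast, Equiv.Perm.coe_pow, hn]⟩
  · intro h
    obtain ⟨n, hn⟩ := h.exists_nat_pow_eq
    exact ⟨n, by rw [← hn, Equiv.Perm.coe_pow]⟩

open Classical in
@[to_additive]
theorem prod_faceWalk_darts {M : Type*} [CommMonoid M] (f : r.Face) (φ : G.Dart → M) :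
    ((r.faceWalk f).darts.map φ).prod = ∏ d with r.face d = f, φ d := by
  rw [← List.prod_toFinset _ (r.faceWalk_darts_nodup f)]
  refine Finset.prod_congr ?_ fun _ _ => rfl
  ext d
  simp [mem_faceWalk_darts]

@[to_additive]
theorem prod_prod_faceWalk_darts [Fintype r.Face] {M : Type*} [CommMonoid M] (φ : G.Dart → M) :
    ∏ f, ((r.faceWalk f).darts.map φ).prod = ∏ d, φ d := by
  classical
  simp only [prod_faceWalk_darts]
  exact Finset.prod_fiberwise _ _ _

theorem sum_smul_chain_apply [Fintype r.Face] (c : r.Face → ZMod 2) (d : G.Dart) :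
    (∑ f, c f • chain (r.faceWalk f)) (dartEdge d) = c (r.face d) + c (r.face d.symm) := by
  classical
  have h1 : ∀ f, c f • chain (r.faceWalk f) = ((r.faceWalk f).darts.map fun d =>
      c (r.face d) • (Pi.single (dartEdge d) 1 : G.edgeSet → ZMod 2)).sum := by
    intro f
    rw [chain_eq_sum, List.smul_sum, List.map_map]
    congr 1
    refine List.map_congr_left fun d hd => ?_
    rw [← (r.mem_faceWalk_darts f d).1 hd]
    rfl
  rw [Finset.sum_congr rfl fun f _ => h1 f, sum_sum_faceWalk_darts]
  simp only [Finset.sum_apply, Pi.smul_apply, Pi.single_apply,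
    smul_eq_mul, mul_ite, mul_one, mul_zero]
  rw [← Finset.sum_filter]
  have h2 : ({d' | dartEdge d = dartEdge d'} : Finset G.Dart) = {d, d.symm} := by
    rw [← d.edge_fiber]
    ext d'
    simp [dartEdge, Subtype.ext_iff, eq_comm]
  rw [h2, Finset.sum_pair d.symm_ne.symm]

/-- A function on the darts that is invariant under the face permutation and under reversal is
constant if the graph is connected. -/
theorem eq_of_invariant (hG : G.Connected) {α : Type*} {φ : G.Dart → α}
    (h : ∀ d, φ (r.facePerm d) = φ d) (h' : ∀ d : G.Dart, φ d.symm = φ d) (d d' : G.Dart) :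
    φ d = φ d' := by
  have hnext : ∀ d, φ (r.next d) = φ d := fun d => by
    have := h d.symm
    rw [h'] at this
    rw [← this]
    simp [facePerm]
  have hfst : ∀ d d' : G.Dart, d.fst = d'.fst → φ d = φ d' := by
    intro d d' hd
    obtain ⟨n, rfl⟩ := (r.next_sameCycle d d' hd).exists_nat_pow_eq
    rw [Equiv.Perm.coe_pow]
    clear hd
    induction n with
    | zero => rfl
    | succ n ih => rw [Function.iterate_succ_apply', hnext, ih]
  have key : ∀ {u v : V} (_ : G.Walk u v) (d d' : G.Dart), d.fst = u → d'.fst = v → φ d = φ d' := by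
    intro u v p
    induction p with
    | nil => exact fun d d' h1 h2 => hfst d d' (h1.trans h2.symm)
    | @cons u w v hadj p ih =>
      intro d d' h1 h2
      rw [hfst d ⟨(u, w), hadj⟩ h1, ← h' ⟨(u, w), hadj⟩]
      exact ih _ d' rfl h2
  exact key (hG.preconnected d.fst d'.fst).some d d' rfl rfl

/-- A mod 2 relation between the boundaries of the faces has constant coefficients. -/
theorem sum_smul_chain_eq_zero_iff [Fintype r.Face] (hG : G.Connected) (c : r.Face → ZMod 2) :
    ∑ f, c f • chain (r.faceWalk f) = 0 ↔ ∀ f f', c f = c f' := by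
  constructor
  · intro h f f'
    rw [← r.face_out f, ← r.face_out f']
    refine r.eq_of_invariant hG (φ := fun d => c (r.face d)) (fun d => by rw [face_facePerm])
      (fun d => ?_) _ _
    have := r.sum_smul_chain_apply c d
    rw [h, Pi.zero_apply] at this
    exact (CharTwo.add_eq_zero.1 this.symm).symm
  · intro h
    ext e
    obtain ⟨e, he⟩ := e
    induction e with | _ a b
    rw [show (⟨s(a, b), he⟩ : G.edgeSet) = dartEdge ⟨(a, b), he⟩ from rfl, sum_smul_chain_apply,
      h _ (r.face (SimpleGraph.Dart.symm _)), CharTwo.add_self_eq_zero, Pi.zero_apply]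

end RotationSystem

/-! ### Homology of the surface -/

namespace SurfaceEmbedding

variable [DecidableRel G.Adj] {s : SurfaceEmbedding G}

theorem nonempty_loopSystem (hG : G.Connected) (s : SurfaceEmbedding G) :
    Nonempty s.LoopSystem := by
  have htop : Submodule.span (ZMod 2)
      (Set.range fun C : Σ u, G.Walk u u => s.homologyClass C.2) = ⊤ := by
    have h1 : Submodule.span (ZMod 2) (Set.range fun C : Σ u, G.Walk u u =>
        (⟨chain C.2, chain_mem_cycles C.2⟩ : cycles G)) = ⊤ := by
      refine Submodule.map_injective_of_injective (cycles G).subtype_injective ?_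
      rw [Submodule.map_span, Submodule.map_top, Submodule.range_subtype, ← Set.range_comp]
      refine le_antisymm (Submodule.span_le.2 ?_) (cycles_le_span hG)
      rintro _ ⟨C, rfl⟩
      exact chain_mem_cycles C.2
    have h2 := congrArg (Submodule.map (s.boundaries.submoduleOf (cycles G)).mkQ) h1
    rw [Submodule.map_span, Submodule.map_top, Submodule.range_mkQ, ← Set.range_comp] at h2
    exact h2
  obtain ⟨f, hf, hspan, hli⟩ := Submodule.exists_fun_fin_finrank_span_eq (ZMod 2)
    (Set.range fun C : Σ u, G.Walk u u => s.homologyClass C.2)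
  have hrank : Module.finrank (ZMod 2) (Submodule.span (ZMod 2)
      (Set.range fun C : Σ u, G.Walk u u => s.homologyClass C.2)) = s.b₁ := by
    rw [htop, finrank_top]; rfl
  replace hspan := hspan.trans htop
  choose C hC using hf
  let g : Fin s.b₁ ≃ Fin _ := finCongr hrank.symm
  have hg : (fun a => s.homologyClass (C (g a)).2) = f ∘ g := funext fun a => hC (g a)
  refine ⟨⟨fun a => (C (g a)).1, fun a => (C (g a)).2, ?_, ?_⟩⟩
  · rw [hg]
    exact hli.comp _ g.injective
  · rw [hg, Set.range_comp, g.surjective.range_eq, Set.image_univ, hspan]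

/-- An admissible set of plaquettes: all of them, or all but one if the surface is closed. -/
theorem plaquettes_cases {Q : Finset s.Plaquette} (hQ : Q.card + s.b₂ = Fintype.card s.Plaquette) :
    (s.holes.Nonempty ∧ ∀ p, p ∈ Q) ∨
      (s.holes = ∅ ∧ ∃ p₀, p₀ ∉ Q ∧ ∀ p, p ≠ p₀ → p ∈ Q) := by
  classical
  by_cases h : s.holes = ∅
  · right
    refine ⟨h, ?_⟩
    have hb : s.b₂ = 1 := by simp [b₂, h]
    have hc : Qᶜ.card = 1 := by rw [Finset.card_compl]; omega
    obtain ⟨p₀, hp₀⟩ := Finset.card_eq_one.1 hc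
    refine ⟨p₀, by simpa using Finset.ext_iff.1 hp₀ p₀, fun p hp => ?_⟩
    have := Finset.ext_iff.1 hp₀ p
    simp only [Finset.mem_compl, Finset.mem_singleton, hp, iff_false, not_not] at this
    exact this
  · left
    refine ⟨Set.nonempty_iff_ne_empty.2 h, ?_⟩
    have hb : s.b₂ = 0 := by simp [b₂, h]
    rw [hb, add_zero, Finset.card_eq_iff_eq_univ] at hQ
    simp [hQ]

theorem exists_face_notMem {Q : Finset s.Plaquette}
    (hQ : Q.card + s.b₂ = Fintype.card s.Plaquette) :
    ∃ f : s.Face, f ∉ Set.range fun i : {p // p ∈ Q} => i.1.1 := by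
  rcases plaquettes_cases hQ with ⟨⟨f, hf⟩, -⟩ | ⟨-, p₀, hp₀, -⟩
  · refine ⟨f, ?_⟩
    rintro ⟨i, rfl⟩
    exact i.1.2 hf
  · refine ⟨p₀.1, ?_⟩
    rintro ⟨i, hi⟩
    exact hp₀ (Subtype.ext hi ▸ i.2)

theorem linearIndependent_faces (hG : G.Connected) {Q : Finset s.Plaquette}
    (hQ : Q.card + s.b₂ = Fintype.card s.Plaquette) :
    LinearIndependent (ZMod 2) fun i : {p // p ∈ Q} => chain (s.faceWalk i.1.1) := by
  classical
  have : Fintype s.Face := Fintype.ofFinite _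
  rw [Fintype.linearIndependent_iff]
  intro g hg i
  have hinj : Function.Injective fun i : {p // p ∈ Q} => i.1.1 :=
    Subtype.val_injective.comp Subtype.val_injective
  let c : s.Face → ZMod 2 := Function.extend (fun i : {p // p ∈ Q} => i.1.1) g 0
  have hc : ∑ f, c f • chain (s.faceWalk f) = 0 := by
    rw [← hg]
    refine (Fintype.sum_of_injective _ hinj _ _ (fun f hf => ?_) fun i => ?_).symm
    · simp only [c]
      rw [Function.extend_apply' _ _ _ hf, Pi.zero_apply, zero_smul]
    · simp only [c]
      rw [hinj.extend_apply]
  obtain ⟨f, hf⟩ := exists_face_notMem hQ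
  have := (s.sum_smul_chain_eq_zero_iff hG c).1 hc i.1.1 f
  simp only [c] at this
  rwa [hinj.extend_apply, Function.extend_apply' _ _ _ hf, Pi.zero_apply] at this

theorem span_faces (hG : G.Connected) {Q : Finset s.Plaquette}
    (hQ : Q.card + s.b₂ = Fintype.card s.Plaquette) :
    Submodule.span (ZMod 2) (Set.range fun i : {p // p ∈ Q} => chain (s.faceWalk i.1.1)) =
      s.boundaries := by
  classical
  have : Fintype s.Face := Fintype.ofFinite _
  refine le_antisymm (Submodule.span_mono ?_) (Submodule.span_le.2 ?_)
  · rintro _ ⟨i, rfl⟩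
    exact ⟨i.1, rfl⟩
  · rintro _ ⟨p, rfl⟩
    have hmem : ∀ p : s.Plaquette, p ∈ Q → chain (s.faceWalk p.1) ∈ Submodule.span (ZMod 2)
        (Set.range fun i : {p // p ∈ Q} => chain (s.faceWalk i.1.1)) :=
      fun p hp => Submodule.subset_span ⟨⟨p, hp⟩, rfl⟩
    rcases plaquettes_cases hQ with ⟨-, h⟩ | ⟨h, p₀, hp₀, hQ'⟩
    · exact hmem p (h p)
    · by_cases hp : p = p₀
      · subst hp
        have h1 := (s.sum_smul_chain_eq_zero_iff hG fun _ => 1).2 fun _ _ => rfl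
        rw [← Finset.add_sum_erase _ _ (Finset.mem_univ p.1), one_smul, add_eq_zero_iff_eq_neg] at h1
        dsimp only
        rw [h1]
        refine Submodule.neg_mem _ (Submodule.sum_mem _ fun f hf => Submodule.smul_mem _ _ ?_)
        have hfh : f ∉ s.holes := by simp [h]
        exact hmem ⟨f, hfh⟩ (hQ' _ fun h' => Finset.ne_of_mem_erase hf (congrArg Subtype.val h'))
      · exact hmem p (hQ' p hp)

theorem boundaries_le_cycles : s.boundaries ≤ cycles G := by
  refine Submodule.span_le.2 ?_
  rintro _ ⟨p, rfl⟩
  exact chain_mem_cycles _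

theorem card_add_b₁ (hG : G.Connected) {Q : Finset s.Plaquette}
    (hQ : Q.card + s.b₂ = Fintype.card s.Plaquette) :
    Q.card + s.b₁ = Module.finrank (ZMod 2) (cycles G) := by
  have h1 := (s.boundaries.submoduleOf (cycles G)).finrank_quotient_add_finrank
  rw [(Submodule.submoduleOfEquivOfLe boundaries_le_cycles).finrank_eq] at h1
  have h2 := finrank_span_eq_card (linearIndependent_faces hG hQ)
  rw [span_faces hG hQ, Fintype.card_coe] at h2
  rw [h2] at h1
  rw [add_comm]
  exact h1

variable (l : s.LoopSystem) (Q : Finset s.Plaquette)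

/-- The boundary walks of the plaquettes in `Q` and the loops. -/
def strongWalk : {p // p ∈ Q} ⊕ Fin s.b₁ → Σ u, G.Walk u u
  | Sum.inl p => ⟨_, s.faceWalk p.1.1⟩
  | Sum.inr a => ⟨_, l.loop a⟩

/-- The mod 2 cycles of the plaquettes in `Q` and the loops. -/
def strongCycle (i : {p // p ∈ Q} ⊕ Fin s.b₁) : cycles G :=
  ⟨chain (strongWalk l Q i).2, chain_mem_cycles _⟩

variable {Q}

theorem linearIndependent_strongCycle (hG : G.Connected)
    (hQ : Q.card + s.b₂ = Fintype.card s.Plaquette) :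
    LinearIndependent (ZMod 2) (strongCycle l Q) := by
  let f : {p // p ∈ Q} → s.boundaries.submoduleOf (cycles G) := fun p =>
    ⟨⟨chain (s.faceWalk p.1.1), chain_mem_cycles _⟩, Submodule.subset_span ⟨p.1, rfl⟩⟩
  have hf : LinearIndependent (ZMod 2) f := by
    refine LinearIndependent.of_comp
      ((cycles G).subtype ∘ₗ (s.boundaries.submoduleOf (cycles G)).subtype) ?_
    exact linearIndependent_faces hG hQ
  have h := hf.sumElim_of_quotient
    (fun a => (⟨chain (l.loop a), chain_mem_cycles _⟩ : cycles G)) l.linearIndependent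
  have heq : strongCycle l Q = Sum.elim (fun p => (f p : cycles G))
      fun a => (⟨chain (l.loop a), chain_mem_cycles _⟩ : cycles G) := by
    funext i
    rcases i with i | i <;> rfl
  rw [heq]
  exact h

theorem span_strongCycle (hG : G.Connected)
    (hQ : Q.card + s.b₂ = Fintype.card s.Plaquette) :
    Submodule.span (ZMod 2) (Set.range (strongCycle l Q)) = ⊤ := by
  refine (linearIndependent_strongCycle l hG hQ).span_eq_top_of_card_eq_finrank' ?_
  rw [Fintype.card_sum, Fintype.card_coe, Fintype.card_fin, card_add_b₁ hG hQ]

/-- The cycle of a closed walk is a sum of elementary cycles. -/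
theorem exists_chain_eq_sum (hG : G.Connected)
    (hQ : Q.card + s.b₂ = Fintype.card s.Plaquette) {u : V} (C : G.Walk u u) :
    ∃ T : Finset ({p // p ∈ Q} ⊕ Fin s.b₁),
      chain C = ∑ i ∈ T, chain (strongWalk l Q i).2 := by
  have h : (⟨chain C, chain_mem_cycles C⟩ : cycles G) ∈
      Submodule.span (ZMod 2) (Set.range (strongCycle l Q)) := by
    rw [span_strongCycle l hG hQ]; trivial
  obtain ⟨c, hc⟩ := (Submodule.mem_span_range_iff_exists_fun _).1 h
  refine ⟨({i | c i ≠ 0} : Finset _), ?_⟩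
  have hc' := congrArg (cycles G).subtype hc
  rw [map_sum] at hc'
  refine hc'.symm.trans ?_
  rw [Finset.sum_filter]
  refine Finset.sum_congr rfl fun i _ => ?_
  rw [map_smul]
  rcases zmod_two_cases (c i) with h | h
  · simp [h]
  · rw [h, one_smul, if_pos one_ne_zero]; rfl

/-- The elementary cycles are independent. -/
theorem exists_sum_chain_eq_one (hG : G.Connected)
    (hQ : Q.card + s.b₂ = Fintype.card s.Plaquette) {T : Finset ({p // p ∈ Q} ⊕ Fin s.b₁)}
    (hT : T.Nonempty) : ∃ e, ∑ i ∈ T, chain (strongWalk l Q i).2 e = 1 := by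
  by_contra! hne
  have h0 : ∑ i ∈ T, (1 : ZMod 2) • strongCycle l Q i = 0 := by
    refine Subtype.ext ?_
    rw [AddSubmonoidClass.coe_finsetSum]
    ext e
    rw [Finset.sum_apply]
    refine Eq.trans ?_ ((zmod_two_cases _).resolve_right (hne e))
    exact Finset.sum_congr rfl fun i _ => by rw [one_smul]; rfl
  obtain ⟨i, hi⟩ := hT
  exact one_ne_zero (linearIndependent_iff'.1 (linearIndependent_strongCycle l hG hQ) T _ h0 i hi)

theorem exists_plaquettes [Nontrivial V] (hG : G.Connected) (s : SurfaceEmbedding G) :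
    ∃ Q : Finset s.Plaquette, Q.card + s.b₂ = Fintype.card s.Plaquette := by
  classical
  by_cases h : s.holes = ∅
  · obtain ⟨u, v, hne⟩ := exists_pair_ne V
    obtain ⟨w, hw⟩ := hG.preconnected.exists_adj_of_nontrivial u
    let p : s.Plaquette := ⟨s.face ⟨(u, w), hw⟩, by simp [h]⟩
    refine ⟨univ.erase p, ?_⟩
    have hb : s.b₂ = 1 := by simp [b₂, h]
    rw [hb, Finset.card_erase_add_one (Finset.mem_univ p), Finset.card_univ]
  · exact ⟨univ, by simp [b₂, h]⟩

end SurfaceEmbedding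

end

section

variable {V : Type*} [Fintype V] [DecidableEq V] {G : SimpleGraph V} [DecidableRel G.Adj]

instance : Nonempty (Basis G) := ⟨fun _ => ⟨0, by positivity⟩⟩

open SurfaceEmbedding

/-! ### The elementary fluxes -/

namespace Model

variable (m : Model G)

theorem W_projEq {u v : V} (p : G.Walk u v) :
    ProjEq (m.W p) (monomial (fun e : G.edgeSet => m.K e) (chain p)) := by
  classical
  induction p with
  | nil => rw [chain_nil, W_nil, monomial_zero]; exact ProjEq.refl _
  | cons h p ih =>
    rw [chain_cons, W_cons]
    exact ((ProjEq.refl _).mul ih).trans (m.K_projInvolutive.mul_monomial ⟨s(_, _), h⟩ _)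

theorem Gam_ne_zero (v : V) (c) : m.Gam v c ≠ 0 := fun h => by
  have := m.Gam_mul_self v c
  rw [h, zero_mul] at this
  exact zero_ne_one this

theorem interlayerFlux_twComm (d : G.Dart) (e : G.edgeSet) {w : V} (hw : w ∈ (e : Sym2 V)) :
    TwComm (if d.edge = e then 1 else 0) (m.interlayerFlux d)
      (rightAction (m.Gam w (m.color e))) := by
  have := (twComm_zero_iff.2 (leftAction_commute_rightAction (m.Wch d.adj.toWalk)
    (m.Gam w (m.color e)))).mul_left (rightAction_twComm (m.Wch_edge_twComm_Gam d.adj e.2 hw))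
  rwa [zero_add] at this

theorem Wch_closed {u : V} (C : G.Walk u u) : m.Wch C = m.W C := by
  rw [Wch, (m.W_commute_Gch C u).symm.eq, mul_assoc, Gch_mul_self, mul_one]

theorem generated_adjointAction_Wch {ι : Type*} [Fintype ι] {Φ : ι → Module.End ℂ (Op G)}
    (hΦ : ProjInvolutive Φ) {o : G.edgeSet → G.Dart} (ho : ∀ e, (o e).edge = e)
    (h : ∀ e, Generated Φ (m.interlayerFlux (o e))) {u v : V} (p : G.Walk u v) :
    Generated Φ (adjointAction (m.Wch p)) := by
  rw [Wch_eq_prod, adjointAction_list_prod]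
  refine hΦ.generated_list_prod fun d _ => ?_
  have hd : m.interlayerFlux d = m.interlayerFlux (o (dartEdge d)) :=
    m.interlayerFlux_congr (ho (dartEdge d)).symm
  change Generated Φ (m.interlayerFlux d)
  rw [hd]
  exact h (dartEdge d)

theorem interlayerFlux_projInvolutive {ι : Type*} (o : ι → G.Dart) :
    ProjInvolutive fun e => m.interlayerFlux (o e) where
  comm e f := (twComm_zero_iff.2 (m.interlayerFlux_commute (o e) (o f))).projEq
  sq e := by rw [interlayerFlux_mul_self]; exact ProjEq.refl _

end Model

section Elementary

variable (m : Model G) {s : SurfaceEmbedding G} (l : s.LoopSystem) (Q : Finset s.Plaquette)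
  (o : G.edgeSet → G.Dart)

theorem strongFlux_eq (i) : strongFlux m l Q i = m.W (strongWalk l Q i).2 := by
  rcases i with i | i <;> rfl

theorem elementaryFlux_inl (i) :
    elementaryFlux m l Q o (Sum.inl i) = leftAction (m.W (strongWalk l Q i).2) := by
  rw [← strongFlux_eq]; rfl

theorem elementaryFlux_inr (e) : elementaryFlux m l Q o (Sum.inr e) = m.interlayerFlux (o e) := rfl

theorem W_projEq_finProd {u : V} (C : G.Walk u u) {T : Finset ({p // p ∈ Q} ⊕ Fin s.b₁)}
    (h : chain C = ∑ i ∈ T, chain (strongWalk l Q i).2) :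
    ProjEq (m.W C) (finProd T (strongFlux m l Q)) := by
  have := m.K_projInvolutive.list_prod_monomial (Ψ := strongFlux m l Q)
    (x := fun i => chain (strongWalk l Q i).2) T.toList
    fun i _ => by rw [strongFlux_eq]; exact m.W_projEq _
  rw [Finset.sum_map_toList, ← h] at this
  exact (m.W_projEq C).trans this.symm

theorem elementaryFlux_commute (i j) :
    Commute (elementaryFlux m l Q o i) (elementaryFlux m l Q o j) := by
  have key : ∀ i e, Commute (elementaryFlux m l Q o (Sum.inl i))
      (elementaryFlux m l Q o (Sum.inr e)) := by
    intro i e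
    rw [elementaryFlux_inl, elementaryFlux_inr]
    exact (twComm_zero_iff.1 (leftAction_twComm (twComm_zero_iff.2 (m.W_commute_Wch _ _)))).mul_right
      (leftAction_commute_rightAction _ _)
  rcases i with i | i <;> rcases j with j | j
  · rw [elementaryFlux_inl, elementaryFlux_inl]
    exact twComm_zero_iff.1 (leftAction_twComm (twComm_zero_iff.2 (m.W_commute_W _ _)))
  · exact key i j
  · exact (key j i).symm
  · exact m.interlayerFlux_commute _ _

theorem elementaryFlux_isUnit (i) : IsUnit (elementaryFlux m l Q o i) := by
  rcases i with i | i
  · rw [elementaryFlux_inl]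
    exact leftAction_isUnit (m.W_isUnit _)
  · exact m.interlayerFlux_isUnit _

theorem elementaryFlux_projInvolutive : ProjInvolutive (elementaryFlux m l Q o) where
  comm i j := (twComm_zero_iff.2 (elementaryFlux_commute m l Q o i j)).projEq
  sq i := by
    rcases i with i | i
    · rw [elementaryFlux_inl, ← leftAction_mul, m.W_mul_self_closed, leftAction_smul,
        leftAction_one]
      exact ⟨_, pow_ne_zero _ (by norm_num), rfl⟩
    · rw [elementaryFlux_inr, m.interlayerFlux_mul_self]
      exact ProjEq.refl _

theorem lindbladian_elementaryFlux (i) (ρ : Op G) :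
    lindbladian m.H m.jump (elementaryFlux m l Q o i ρ) =
      elementaryFlux m l Q o i (lindbladian m.H m.jump ρ) := by
  rcases i with i | i
  · rw [elementaryFlux_inl]
    exact (m.W_isStrongSymmetry _).lindbladian_mul ρ
  · rw [elementaryFlux_inr, Model.interlayerFlux, adjointAction_apply, adjointAction_apply]
    exact (m.Wch_isWeakSymmetry _).2 ρ

variable {Q o}

/-- A nonempty product of elementary strong fluxes anticommutes with some gamma matrix. -/
theorem exists_Gam_anticomm (hG : G.Connected) (hQ : Q.card + s.b₂ = Fintype.card s.Plaquette)
    {T : Finset ({p // p ∈ Q} ⊕ Fin s.b₁)} (hT : T.Nonempty) :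
    ∃ (v : V) (c : Fin (G.maxDegree + 1)) (a : {p // p ∈ Q} ⊕ Fin s.b₁ → ZMod 2),
      ∑ i ∈ T, a i = 1 ∧ ∀ i, TwComm (a i) (m.W (strongWalk l Q i).2) (m.Gam v c) := by
  obtain ⟨⟨e, he⟩, h⟩ := exists_sum_chain_eq_one l hG hQ hT
  induction e with | _ a b
  exact ⟨a, m.color s(a, b), _, h,
    fun i => m.W_closed_twComm_Gam _ ⟨s(a, b), he⟩ (Sym2.mem_mk_left a b)⟩

theorem elementaryFlux_isIndependent (hG : G.Connected)
    (hQ : Q.card + s.b₂ = Fintype.card s.Plaquette) (ho : ∀ e, (o e).edge = e) :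
    IsIndependent (elementaryFlux m l Q o) := by
  classical
  intro T hT
  by_cases hr : ∃ e, Sum.inr e ∈ T
  · obtain ⟨⟨e, he⟩, heT⟩ := hr
    induction e with | _ a b
    set e : G.edgeSet := ⟨s(a, b), he⟩
    have hB : rightAction (m.Gam a (m.color e)) ≠ 0 := fun h => by
      have := LinearMap.congr_fun h 1
      rw [rightAction_apply, one_mul, m.Gam_isHermitian] at this
      exact m.Gam_ne_zero _ _ this
    refine TwComm.ne_smul_one ?_ (finProd_isUnit (elementaryFlux_isUnit m l Q o)) hB
    have h := TwComm.finProd_left (T := T) (Φ := elementaryFlux m l Q o)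
      (a := fun i => if i = Sum.inr e then 1 else 0) (B := rightAction (m.Gam a (m.color e))) ?_
    · rwa [Finset.sum_ite_eq', if_pos heT] at h
    · rintro (i | f) -
      · rw [if_neg Sum.inl_ne_inr, twComm_zero_iff, elementaryFlux_inl]
        exact leftAction_commute_rightAction _ _
      · have := m.interlayerFlux_twComm (o f) e (Sym2.mem_mk_left a b)
        rw [ho] at this
        simpa only [elementaryFlux_inr, Sum.inr.injEq, Subtype.ext_iff] using this
  · have hT' : T = T.toLeft.disjSum ∅ := by
      rw [← Finset.toLeft_disjSum_toRight (u := T)]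
      congr 1
      · simp
      · rw [Finset.eq_empty_iff_forall_notMem]
        intro e he
        simp only [Finset.mem_toRight] at he
        exact hr ⟨e, he⟩
    have hne : T.toLeft.Nonempty := by
      rw [Finset.nonempty_iff_ne_empty]
      intro h
      rw [h, Finset.disjSum_empty, Finset.map_empty] at hT'
      exact hT.ne_empty hT'
    obtain ⟨v, c, a, ha, hW⟩ := exists_Gam_anticomm m l hG hQ hne
    have hB : leftAction (m.Gam v c) ≠ 0 := fun h => by
      have := LinearMap.congr_fun h 1
      rw [leftAction_apply, mul_one] at this
      exact m.Gam_ne_zero _ _ this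
    refine TwComm.ne_smul_one ?_ (finProd_isUnit (elementaryFlux_isUnit m l Q o)) hB
    have h := TwComm.finProd_left (T := T) (Φ := elementaryFlux m l Q o)
      (a := Sum.elim a 0) (B := leftAction (m.Gam v c)) ?_
    · rw [hT', Finset.sum_disjSum, Finset.sum_empty, add_zero] at h
      simp only [Sum.elim_inl, ha] at h
      rwa [← hT'] at h
    · rintro (i | f) hi
      · rw [elementaryFlux_inl]
        exact leftAction_twComm (hW i)
      · exact absurd ⟨f, hi⟩ hr

theorem strongFlux_generates (hG : G.Connected) (hQ : Q.card + s.b₂ = Fintype.card s.Plaquette)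
    {u : V} (C : G.Walk u u) : IsGeneratedBy (strongFlux m l Q) (m.W C) := by
  obtain ⟨T, hT⟩ := exists_chain_eq_sum l hG hQ C
  obtain ⟨c, -, hc⟩ := W_projEq_finProd m l Q C hT
  exact ⟨T, c, hc⟩

theorem generated_rightAction (hG : G.Connected) (hQ : Q.card + s.b₂ = Fintype.card s.Plaquette)
    (ho : ∀ e, (o e).edge = e) {u : V} (C : G.Walk u u) :
    Generated (elementaryFlux m l Q o) (rightAction (m.W C)) := by
  have hΦ := elementaryFlux_projInvolutive m l Q o
  have hleft : Generated (elementaryFlux m l Q o) (leftAction (m.W C)) := by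
    obtain ⟨T, hT⟩ := exists_chain_eq_sum l hG hQ C
    refine Generated.of_projEq ?_ (leftAction_projEq (W_projEq_finProd m l Q C hT))
    rw [finProd, leftAction_list_prod]
    refine hΦ.generated_list_prod fun i _ => ?_
    exact generated_self (Φ := elementaryFlux m l Q o) (Sum.inl i)
  have hadj : Generated (elementaryFlux m l Q o) (adjointAction (m.W C)) := by
    rw [← m.Wch_closed]
    exact m.generated_adjointAction_Wch hΦ ho
      (fun e => generated_self (Φ := elementaryFlux m l Q o) (Sum.inr e)) C
  refine (hΦ.generated_mul hleft hadj).of_projEq (ProjEq.symm ⟨(-1) ^ C.length,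
    pow_ne_zero _ (by norm_num), ?_⟩)
  rw [adjointAction, ← mul_assoc, ← leftAction_mul, m.W_mul_self_closed, leftAction_smul,
    leftAction_one, smul_mul_assoc, one_mul]

end Elementary

end

section

variable {V : Type*} [Fintype V] [DecidableEq V] {G : SimpleGraph V} [DecidableRel G.Adj]

open SurfaceEmbedding

open scoped IsMulCommutative

/-! ### Flux values -/

theorem mem_fluxValues_iff {n : ℕ} {ω : ℂ} : ω ∈ fluxValues n ↔ ω * ω = (-1) ^ n := by
  unfold fluxValues
  split_ifs with h
  · rw [h.neg_one_pow, mul_self_eq_one_iff]; rfl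
  · rw [(Nat.not_even_iff_odd.1 h).neg_one_pow, ← Complex.I_mul_I, mul_self_eq_mul_self_iff]; rfl

theorem star_mul_self_of_mem_fluxValues {n : ℕ} {ω : ℂ} (h : ω ∈ fluxValues n) :
    star ω * ω = 1 := by
  unfold fluxValues at h
  split_ifs at h <;> rcases h with rfl | rfl <;> simp

theorem ne_zero_of_mem_fluxValues {n : ℕ} {ω : ℂ} (h : ω ∈ fluxValues n) : ω ≠ 0 := by
  rintro rfl
  simpa using star_mul_self_of_mem_fluxValues h

theorem star_of_mem_fluxValues {n : ℕ} {ω : ℂ} (h : ω ∈ fluxValues n) :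
    star ω = (-1) ^ n * ω := by
  rw [← mem_fluxValues_iff.1 h, ← mul_right_inj' (ne_zero_of_mem_fluxValues h), mul_comm,
    star_mul_self_of_mem_fluxValues h]
  have h2 : (ω * ω) * (ω * ω) = 1 := by
    rw [mem_fluxValues_iff.1 h, ← mul_pow]; simp
  rw [← h2]; ring

theorem card_fluxValues (n : ℕ) : Nat.card (fluxValues n) = 2 := by
  rw [Nat.card_coe_set_eq]
  unfold fluxValues
  split_ifs
  · exact Set.ncard_pair (by norm_num)
  · refine Set.ncard_pair fun h => ?_
    have := congrArg Complex.im h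
    norm_num at this

/-! ### Products of projections -/

theorem finProd_isStarProjection {ι R : Type*} [Ring R] [StarRing R] {T : Finset ι} {f : ι → R}
    (h : ∀ i, IsStarProjection (f i)) (hc : ∀ i j, Commute (f i) (f j)) :
    IsStarProjection (finProd T f) := by
  unfold finProd
  induction T.toList with
  | nil => simp
  | cons i l ih =>
    rw [List.map_cons, List.prod_cons]
    refine (h i).mul ih (Commute.list_prod_right _ _ fun A hA => ?_)
    obtain ⟨j, -, rfl⟩ := List.mem_map.1 hA
    exact hc i j

theorem finProd_mulVec {ι n : Type*} [Fintype n] [DecidableEq n] {T : Finset ι}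
    {f : ι → Matrix n n ℂ} {x : n → ℂ} (h : ∀ i, f i *ᵥ x = x) : finProd T f *ᵥ x = x := by
  unfold finProd
  induction T.toList with
  | nil => simp
  | cons i l ih => rw [List.map_cons, List.prod_cons, ← Matrix.mulVec_mulVec, ih, h i]

/-! ### The algebra of fluxes -/

namespace Model

variable (m : Model G)

/-- The algebra generated by the closed strings. -/
def fluxAlgebra : Subalgebra ℂ (Op G) :=
  Algebra.adjoin ℂ {A | ∃ (u : V) (C : G.Walk u u), A = m.W C}

instance : IsMulCommutative m.fluxAlgebra :=
  Algebra.isMulCommutative_adjoin ℂ (by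
    rintro _ ⟨u, C, rfl⟩ _ ⟨v, C', rfl⟩
    exact (m.W_commute_W C C').eq)

/-- A closed string as an element of the flux algebra. -/
def fluxElem {u : V} (C : G.Walk u u) : m.fluxAlgebra :=
  ⟨m.W C, Algebra.subset_adjoin ⟨u, C, rfl⟩⟩

theorem coe_fluxElem {u : V} (C : G.Walk u u) : (m.fluxElem C : Op G) = m.W C := rfl

theorem coe_finProd {ι : Type*} (T : Finset ι) (f : ι → m.fluxAlgebra) :
    ((∏ i ∈ T, f i : m.fluxAlgebra) : Op G) = finProd T fun i => (f i : Op G) := by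
  rw [← Finset.prod_map_toList, finProd]
  refine (map_list_prod m.fluxAlgebra.val _).trans ?_
  rw [List.map_map]
  rfl

section TotalFlux

variable {r : V} (P : ∀ v, G.Walk r v)

/-- The closed walk that reaches a dart along the walks `P`, follows it and returns. -/
def basedLoop (d : G.Dart) : G.Walk r r :=
  (P d.fst).append (SimpleGraph.Walk.cons d.adj (P d.snd).reverse)

theorem W_reverse_mul {u v : V} (p : G.Walk u v) : m.W p.reverse * m.W p = 1 := by
  have := m.W_mul_reverse p.reverse
  rwa [SimpleGraph.Walk.reverse_reverse] at this

theorem W_basedLoop (d : G.Dart) :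
    m.W (basedLoop P d) = m.W (P d.fst) * (m.K d.edge * m.W (P d.snd).reverse) := by
  rw [basedLoop, W_append, W_cons]
  rfl

theorem fluxElem_basedLoop_mul_symm (d : G.Dart) :
    m.fluxElem (basedLoop P d) * m.fluxElem (basedLoop P d.symm) = 1 := by
  refine Subtype.ext ?_
  change m.W (basedLoop P d) * m.W (basedLoop P d.symm) = 1
  rw [W_basedLoop, W_basedLoop, SimpleGraph.Dart.edge_symm]
  change m.W (P d.fst) * (m.K d.edge * m.W (P d.snd).reverse) *
    (m.W (P d.snd) * (m.K d.edge * m.W (P d.fst).reverse)) = 1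
  calc _ = m.W (P d.fst) * (m.K d.edge * (m.W (P d.snd).reverse * m.W (P d.snd)) * m.K d.edge) *
        m.W (P d.fst).reverse := by simp only [mul_assoc]
    _ = 1 := by rw [W_reverse_mul, mul_one, m.K_mul_self _ d.edge_mem, mul_one, W_mul_reverse]

theorem prod_basedLoop {u v : V} (p : G.Walk u v) :
    (p.darts.map fun d => m.W (basedLoop P d)).prod =
      m.W (P u) * (m.W p * m.W (P v).reverse) := by
  induction p with
  | nil => simp [W_mul_reverse]
  | @cons u w v h p ih =>
    rw [SimpleGraph.Walk.darts_cons, List.map_cons, List.prod_cons, ih, W_basedLoop, W_cons]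
    change m.W (P u) * (m.K s(u, w) * m.W (P w).reverse) *
      (m.W (P w) * (m.W p * m.W (P v).reverse)) = _
    calc _ = m.W (P u) * (m.K s(u, w) * (m.W (P w).reverse * m.W (P w)) * (m.W p *
          m.W (P v).reverse)) := by simp only [mul_assoc]
      _ = _ := by rw [W_reverse_mul]; simp only [mul_assoc, mul_one]

theorem fluxElem_eq_prod {u : V} (C : G.Walk u u) :
    m.fluxElem C = (C.darts.map fun d => m.fluxElem (basedLoop P d)).prod := by
  refine Subtype.ext ?_
  refine Eq.trans ?_ (map_list_prod m.fluxAlgebra.val _).symm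
  rw [List.map_map]
  refine Eq.trans ?_ (m.prod_basedLoop P C).symm
  rw [coe_fluxElem, ← mul_assoc, ← (m.W_commute_W C (P u)).eq, mul_assoc, W_mul_reverse, mul_one]

/-- The total flux through all the faces of a closed surface is trivial. -/
theorem prod_fluxElem_faceWalk (hG : G.Connected) (r : RotationSystem G) [Fintype r.Face] :
    ∏ f, m.fluxElem (r.faceWalk f) = 1 := by
  obtain ⟨x⟩ := hG.nonempty
  let P : ∀ v, G.Walk x v := fun v => (hG.preconnected x v).some
  rw [Finset.prod_congr rfl fun f _ => m.fluxElem_eq_prod P (r.faceWalk f),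
    r.prod_prod_faceWalk_darts]
  exact Finset.prod_involution (fun d _ => d.symm) (fun d _ => m.fluxElem_basedLoop_mul_symm P d)
    (fun d _ _ => d.symm_ne) (fun _ _ => Finset.mem_univ _)
    (fun d _ => SimpleGraph.Dart.symm_symm d)

end TotalFlux

/-! #### Spectral projectors of the fluxes -/

/-- The spectral projector of a closed string. -/
def fluxProj {u : V} (C : G.Walk u u) (ω : ℂ) : m.fluxAlgebra :=
  (1 / 2 : ℂ) • (1 + star ω • m.fluxElem C)

theorem coe_fluxProj {u : V} (C : G.Walk u u) (ω : ℂ) :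
    (m.fluxProj C ω : Op G) = (1 / 2 : ℂ) • (1 + star ω • m.W C) := rfl

variable {u : V} {C : G.Walk u u} {ω : ℂ}

theorem fluxElem_mul_self (C : G.Walk u u) :
    m.fluxElem C * m.fluxElem C = (-1 : ℂ) ^ C.length • 1 :=
  Subtype.ext (m.W_mul_self_closed C)

theorem fluxElem_mul_fluxProj (hω : ω ∈ fluxValues C.length) :
    m.fluxElem C * m.fluxProj C ω = ω • m.fluxProj C ω := by
  have h : star ω * (-1) ^ C.length = ω := by
    rw [star_of_mem_fluxValues hω, mul_right_comm, ← mul_pow]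
    simp
  rw [fluxProj, mul_smul_comm, smul_comm ω]
  congr 1
  rw [mul_add, mul_one, mul_smul_comm, fluxElem_mul_self, smul_smul, h, smul_add, smul_smul,
    mul_comm ω, star_mul_self_of_mem_fluxValues hω, one_smul, add_comm]

theorem fluxProj_isStarProjection (hω : ω ∈ fluxValues C.length) :
    IsStarProjection (m.fluxProj C ω : Op G) := by
  have hsq : m.fluxProj C ω * m.fluxProj C ω = m.fluxProj C ω := by
    nth_rewrite 1 [fluxProj]
    rw [smul_mul_assoc, add_mul, one_mul, smul_mul_assoc, fluxElem_mul_fluxProj m hω, smul_smul,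
      star_mul_self_of_mem_fluxValues hω, one_smul, ← two_smul ℂ, smul_smul]
    norm_num
  refine ⟨congrArg Subtype.val hsq, ?_⟩
  rw [coe_fluxProj, IsSelfAdjoint, star_smul, star_add, star_smul, star_one, star_star,
    Matrix.star_eq_conjTranspose, W_conjTranspose_closed, smul_smul, star_of_mem_fluxValues hω,
    mul_comm ω]
  simp

theorem fluxProj_mulVec {x : Basis G → ℂ} (hω : ω ∈ fluxValues C.length)
    (hx : m.W C *ᵥ x = ω • x) : (m.fluxProj C ω : Op G) *ᵥ x = x := by
  rw [coe_fluxProj, Matrix.smul_mulVec, Matrix.add_mulVec, Matrix.smul_mulVec, hx, smul_smul,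
    star_mul_self_of_mem_fluxValues hω, one_smul, Matrix.one_mulVec, ← two_smul ℂ, smul_smul]
  norm_num

/-- Elements of the flux algebra commute with whatever commutes with all closed strings. -/
theorem fluxAlgebra_commute {A B : Op G} (hA : A ∈ m.fluxAlgebra)
    (hB : ∀ (u : V) (C : G.Walk u u), Commute (m.W C) B) : Commute A B := by
  induction hA using Algebra.adjoin_induction with
  | mem A hA =>
    obtain ⟨u, C, rfl⟩ := hA
    exact hB u C
  | algebraMap c => exact Algebra.commutes c B
  | add A A' _ _ h h' => exact h.add_left h'
  | mul A A' _ _ h h' => exact h.mul_left h'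

end Model

/-! ### The projector of a flux sector -/

section Sector

variable (m : Model G) {s : SurfaceEmbedding G} {l : s.LoopSystem} (w : StrongConfig l)

/-- The projector of a flux sector as an element of the flux algebra. -/
def sectorElem : m.fluxAlgebra :=
  (∏ a, m.fluxProj (l.loop a) (w.loop a)) * ∏ p : s.Plaquette, m.fluxProj (s.faceWalk p.1) (w.plaq p)

theorem projector_eq : projector m w =
    finProd univ (fun a => (m.fluxProj (l.loop a) (w.loop a) : Op G)) *
      finProd univ fun p : s.Plaquette => (m.fluxProj (s.faceWalk p.1) (w.plaq p) : Op G) :=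
  rfl

theorem coe_sectorElem : (sectorElem m w : Op G) = projector m w := by
  change (↑(∏ a, m.fluxProj (l.loop a) (w.loop a)) : Op G) *
    ↑(∏ p : s.Plaquette, m.fluxProj (s.faceWalk p.1) (w.plaq p)) = _
  rw [m.coe_finProd, m.coe_finProd, projector_eq]

theorem fluxElem_plaq_mul_sectorElem (p : s.Plaquette) :
    m.fluxElem (s.faceWalk p.1) * sectorElem m w = w.plaq p • sectorElem m w := by
  classical
  rw [sectorElem, ← Finset.mul_prod_erase univ (fun p : s.Plaquette => m.fluxProj (s.faceWalk p.1)
    (w.plaq p)) (Finset.mem_univ p), mul_left_comm, ← mul_assoc (m.fluxElem _),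
    m.fluxElem_mul_fluxProj (w.plaq_mem p), smul_mul_assoc, mul_smul_comm]

theorem fluxElem_loop_mul_sectorElem (a : Fin s.b₁) :
    m.fluxElem (l.loop a) * sectorElem m w = w.loop a • sectorElem m w := by
  rw [sectorElem, ← Finset.mul_prod_erase univ (fun a => m.fluxProj (l.loop a) (w.loop a))
    (Finset.mem_univ a), ← mul_assoc, ← mul_assoc (m.fluxElem _),
    m.fluxElem_mul_fluxProj (w.loop_mem a), smul_mul_assoc, smul_mul_assoc]

theorem W_plaq_mul_projector (p : s.Plaquette) :
    m.W (s.faceWalk p.1) * projector m w = w.plaq p • projector m w := by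
  rw [← coe_sectorElem]
  exact congrArg Subtype.val (fluxElem_plaq_mul_sectorElem m w p)

theorem W_loop_mul_projector (a : Fin s.b₁) :
    m.W (l.loop a) * projector m w = w.loop a • projector m w := by
  rw [← coe_sectorElem]
  exact congrArg Subtype.val (fluxElem_loop_mul_sectorElem m w a)

theorem projector_commute {B : Op G} (hB : ∀ (u : V) (C : G.Walk u u), Commute (m.W C) B) :
    Commute (projector m w) B :=
  m.fluxAlgebra_commute (coe_sectorElem m w ▸ (sectorElem m w).2) hB

theorem fluxAlgebra_mul_comm (A B : m.fluxAlgebra) : Commute (A : Op G) B :=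
  congrArg Subtype.val (mul_comm A B)

theorem projector_isStarProjection : IsStarProjection (projector m w) := by
  have h1 := finProd_isStarProjection (T := univ)
    (fun a => m.fluxProj_isStarProjection (w.loop_mem a))
    fun a b => fluxAlgebra_mul_comm m _ _
  have h2 := finProd_isStarProjection (T := univ)
    (fun p => m.fluxProj_isStarProjection (w.plaq_mem p))
    fun p q => fluxAlgebra_mul_comm m _ _
  rw [projector_eq]
  refine h1.mul h2 ?_
  rw [← m.coe_finProd, ← m.coe_finProd]
  exact fluxAlgebra_mul_comm m _ _

theorem projector_mulVec_eq_iff (x : Basis G → ℂ) : projector m w *ᵥ x = x ↔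
    (∀ p, m.W (s.faceWalk p.1) *ᵥ x = w.plaq p • x) ∧
      ∀ a, m.W (l.loop a) *ᵥ x = w.loop a • x := by
  constructor
  · intro h
    constructor
    · intro p
      rw [← h, Matrix.mulVec_mulVec, W_plaq_mul_projector, Matrix.smul_mulVec]
    · intro a
      rw [← h, Matrix.mulVec_mulVec, W_loop_mul_projector, Matrix.smul_mulVec]
  · rintro ⟨h1, h2⟩
    rw [projector_eq, ← Matrix.mulVec_mulVec,
      finProd_mulVec fun p => m.fluxProj_mulVec (w.plaq_mem p) (h1 p),
      finProd_mulVec fun a => m.fluxProj_mulVec (w.loop_mem a) (h2 a)]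

/-- The flux values of the plaquettes in `Q` and of the loops. -/
def StrongConfig.value (Q : Finset s.Plaquette) : {p // p ∈ Q} ⊕ Fin s.b₁ → ℂ :=
  Sum.elim (fun p => w.plaq p.1) w.loop

theorem StrongConfig.value_mem (Q : Finset s.Plaquette) (i) :
    w.value Q i ∈ fluxValues (strongWalk l Q i).2.length := by
  rcases i with i | i
  · exact w.plaq_mem i.1
  · exact w.loop_mem i

/-- On a closed surface one plaquette may be omitted from the projector. -/
theorem sectorElem_eq_prod (hG : G.Connected) {Q : Finset s.Plaquette}
    (hQ : Q.card + s.b₂ = Fintype.card s.Plaquette) :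
    sectorElem m w = ∏ i, m.fluxProj (strongWalk l Q i).2 (w.value Q i) := by
  classical
  have hR : ∏ i, m.fluxProj (strongWalk l Q i).2 (w.value Q i) =
      (∏ a, m.fluxProj (l.loop a) (w.loop a)) *
        ∏ p ∈ Q, m.fluxProj (s.faceWalk p.1) (w.plaq p) := by
    rw [Fintype.prod_sum_type, mul_comm, ← Finset.prod_coe_sort Q]
    rfl
  rcases plaquettes_cases hQ with ⟨-, h⟩ | ⟨h, p₀, hp₀, hQ'⟩
  · rw [hR, sectorElem, Finset.eq_univ_iff_forall.2 h]
  · have huniv : (univ : Finset s.Plaquette) = insert p₀ Q := by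
      ext p
      by_cases hp : p = p₀
      · simp [hp]
      · simp [hQ' p hp]
    set R := ∏ p ∈ Q, m.fluxProj (s.faceWalk p.1) (w.plaq p) with hRdef
    have heig : ∀ p ∈ Q, m.fluxElem (s.faceWalk p.1) * R = w.plaq p • R := by
      intro p hp
      rw [hRdef, ← Finset.mul_prod_erase Q _ hp, ← mul_assoc,
        m.fluxElem_mul_fluxProj (w.plaq_mem p), smul_mul_assoc]
    have hprod : ∀ S ⊆ Q, (∏ p ∈ S, m.fluxElem (s.faceWalk p.1)) * R =
        (∏ p ∈ S, w.plaq p) • R := by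
      intro S
      induction S using Finset.induction_on with
      | empty => intro _; simp
      | insert p S hp ih =>
        intro hS
        rw [Finset.prod_insert hp, Finset.prod_insert hp, mul_assoc,
          ih ((Finset.subset_insert _ _).trans hS), mul_smul_comm, heig p (hS (by simp)),
          smul_smul, mul_comm]
    have htot : m.fluxElem (s.faceWalk p₀.1) * ∏ p ∈ Q, m.fluxElem (s.faceWalk p.1) = 1 := by
      have : Fintype s.Face := Fintype.ofFinite _
      rw [← Finset.prod_insert (f := fun p : s.Plaquette => m.fluxElem (s.faceWalk p.1)) hp₀,
        ← huniv, ← m.prod_fluxElem_faceWalk hG s.toRotationSystem]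
      exact Fintype.prod_equiv (Equiv.subtypeUnivEquiv fun f => by simp [h]) _ _ fun _ => rfl
    have hw : w.plaq p₀ * ∏ p ∈ Q, w.plaq p = 1 := by
      rw [← Finset.prod_insert hp₀, ← huniv]
      exact w.total h
    have h0 : m.fluxElem (s.faceWalk p₀.1) * R = w.plaq p₀ • R := by
      have h1 : (∏ p ∈ Q, w.plaq p) • (m.fluxElem (s.faceWalk p₀.1) * R) = R := by
        rw [← mul_smul_comm, ← hprod Q subset_rfl, ← mul_assoc, htot, one_mul]
      nth_rewrite 2 [← h1]
      rw [smul_smul, hw, one_smul]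
    have h2 : m.fluxProj (s.faceWalk p₀.1) (w.plaq p₀) * R = R := by
      rw [Model.fluxProj, smul_mul_assoc, add_mul, one_mul, smul_mul_assoc, h0, smul_smul,
        star_mul_self_of_mem_fluxValues (w.plaq_mem p₀), one_smul, ← two_smul ℂ, smul_smul]
      norm_num
    rw [hR, sectorElem, huniv, Finset.prod_insert hp₀, h2]

theorem trace_eq_zero_of_anticomm {n : Type*} [Fintype n] [DecidableEq n] {A B : Matrix n n ℂ}
    (h : TwComm 1 A B) (hB : B * B = 1) : A.trace = 0 := by
  have h1 : A * B = -(B * A) := by simpa [TwComm] using h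
  have h2 : A.trace = -A.trace := by
    calc A.trace = (A * B * B).trace := by rw [mul_assoc, hB, mul_one]
      _ = -(B * A * B).trace := by rw [h1, neg_mul, Matrix.trace_neg]
      _ = -(A * B * B).trace := by rw [mul_assoc, Matrix.trace_mul_comm]
      _ = -A.trace := by rw [mul_assoc, hB, mul_one]
  exact self_eq_neg.1 h2

theorem sum_halfDim : ∑ v, halfDim G v = G.edgeFinset.card + #{v : V | Odd (G.degree v)} / 2 := by
  have h1 : ∀ v, 2 * halfDim G v = G.degree v + if Odd (G.degree v) then 1 else 0 := by
    intro v
    unfold halfDim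
    split_ifs with h
    · obtain ⟨k, hk⟩ := h; omega
    · obtain ⟨k, hk⟩ := Nat.not_odd_iff_even.1 h; omega
  have h2 : 2 * ∑ v, halfDim G v = 2 * G.edgeFinset.card + #{v : V | Odd (G.degree v)} := by
    rw [Finset.mul_sum, Finset.sum_congr rfl fun v _ => h1 v, Finset.sum_add_distrib,
      G.sum_degrees_eq_twice_card_edges, Finset.card_filter]
  omega

theorem card_strong (hG : G.Connected) {Q : Finset s.Plaquette}
    (hQ : Q.card + s.b₂ = Fintype.card s.Plaquette) :
    Fintype.card ({p // p ∈ Q} ⊕ Fin s.b₁) + Fintype.card V = G.edgeFinset.card + 1 := by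
  rw [Fintype.card_sum, Fintype.card_coe, Fintype.card_fin, card_add_b₁ hG hQ, finrank_cycles hG,
    SimpleGraph.edgeFinset_card]

theorem card_basis [Nonempty V] (hG : G.Connected) {Q : Finset s.Plaquette}
    (hQ : Q.card + s.b₂ = Fintype.card s.Plaquette) :
    Fintype.card (Basis G) = 2 ^ Fintype.card ({p // p ∈ Q} ⊕ Fin s.b₁) * sectorDim G := by
  have h1 := sum_halfDim (G := G)
  have h2 := card_strong hG hQ
  have h3 : 0 < Fintype.card V := Fintype.card_pos
  rw [Fintype.card_pi]
  simp only [Fintype.card_fin]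
  rw [Finset.prod_pow_eq_pow_sum, sectorDim, ← pow_add, ← pow_add, h1]
  congr 1
  omega

theorem trace_projector [Nontrivial V] (hG : G.Connected) :
    (projector m w).trace = sectorDim G := by
  classical
  obtain ⟨Q, hQ⟩ := exists_plaquettes hG s
  have hterm : ∀ T : Finset ({p // p ∈ Q} ⊕ Fin s.b₁), T ≠ ∅ →
      Matrix.trace ((∏ i ∈ T, star (w.value Q i) • m.fluxElem (strongWalk l Q i).2 :
        m.fluxAlgebra) : Op G) = 0 := by
    intro T hT
    obtain ⟨v, c, a, ha, hW⟩ := exists_Gam_anticomm m l hG hQ (Finset.nonempty_iff_ne_empty.2 hT)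
    refine trace_eq_zero_of_anticomm (B := m.Gam v c) ?_ (m.Gam_mul_self v c)
    rw [m.coe_finProd, ← ha]
    exact TwComm.finProd_left fun i _ => (hW i).smul_left _
  have hexp : sectorElem m w = (1 / 2 : ℂ) ^ Fintype.card ({p // p ∈ Q} ⊕ Fin s.b₁) •
      ∑ T ∈ univ.powerset, ∏ i ∈ T, star (w.value Q i) • m.fluxElem (strongWalk l Q i).2 := by
    rw [sectorElem_eq_prod m w hG hQ, ← Finset.prod_one_add]
    simp only [Model.fluxProj]
    rw [← Finset.smul_prod, Finset.card_univ]
  have hcoe : projector m w = (1 / 2 : ℂ) ^ Fintype.card ({p // p ∈ Q} ⊕ Fin s.b₁) •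
      ∑ T ∈ univ.powerset, ((∏ i ∈ T, star (w.value Q i) • m.fluxElem (strongWalk l Q i).2 :
        m.fluxAlgebra) : Op G) := by
    rw [← coe_sectorElem, hexp]
    refine (map_smul m.fluxAlgebra.val _ _).trans ?_
    congr 1
    exact map_sum m.fluxAlgebra.val _ _
  rw [hcoe, Matrix.trace_smul, Matrix.trace_sum, Finset.sum_eq_single ∅]
  · rw [m.coe_finProd]
    simp only [finProd, Finset.toList_empty, List.map_nil, List.prod_nil]
    rw [Matrix.trace_one, card_basis hG hQ, smul_eq_mul]
    push_cast
    rw [← mul_assoc, ← mul_pow]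
    norm_num
  · exact fun T _ hT => hterm T hT
  · simp

theorem sectorDim_ne_zero : (sectorDim G : ℂ) ≠ 0 := by
  simp [sectorDim]

theorem projector_ne_zero [Nontrivial V] (hG : G.Connected) : projector m w ≠ 0 := fun h => by
  have := trace_projector m w hG
  rw [h, Matrix.trace_zero] at this
  exact sectorDim_ne_zero this.symm

theorem lindbladian_projector : lindbladian m.H m.jump (projector m w) = 0 :=
  lindbladian_eq_zero m.jump_isHermitian
    (projector_commute m w fun _ C => (m.W_isStrongSymmetry C).2.1)
    fun j => projector_commute m w fun _ C => ((m.W_isStrongSymmetry C).2.2 j).1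

theorem lindbladian_smul {n ι : Type*} [Fintype n] [DecidableEq n] [Fintype ι]
    (H : Matrix n n ℂ) (L : ι → Matrix n n ℂ) (c : ℂ) (ρ : Matrix n n ℂ) :
    lindbladian H L (c • ρ) = c • lindbladian H L ρ := by
  simp only [lindbladian, Matrix.mul_smul, Matrix.smul_mul, smul_add, Finset.smul_sum, smul_sub,
    smul_comm c]

theorem sectorState_isSteadyState [Nontrivial V] (hG : G.Connected) :
    IsSteadyState m.H m.jump (sectorState m w) := by
  refine ⟨?_, ?_, ?_⟩
  · have h := projector_isStarProjection m w
    have hP : (projector m w).PosSemidef := by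
      have := Matrix.posSemidef_conjTranspose_mul_self (projector m w)
      rwa [← Matrix.star_eq_conjTranspose, h.isSelfAdjoint.star_eq, h.isIdempotentElem.eq] at this
    refine hP.smul ?_
    rw [← Complex.ofReal_natCast, ← Complex.ofReal_inv, Complex.zero_le_real]
    positivity
  · rw [sectorState, Matrix.trace_smul, trace_projector m w hG, smul_eq_mul,
      inv_mul_cancel₀ sectorDim_ne_zero]
  · rw [sectorState, lindbladian_smul, lindbladian_projector, smul_zero]

theorem interlayerFlux_sectorState (d : G.Dart) :
    m.interlayerFlux d (sectorState m w) = sectorState m w := by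
  have h : Commute (projector m w) (m.Wch d.adj.toWalk) :=
    projector_commute m w fun _ C => m.W_commute_Wch C _
  rw [Model.interlayerFlux, adjointAction_apply, sectorState, Matrix.mul_smul, Matrix.smul_mul,
    ← h.eq, mul_assoc, m.Wch_mul_conjTranspose, mul_one]

theorem StrongConfig.ext {w w' : StrongConfig l} (h : ∀ p, w.plaq p = w'.plaq p)
    (h' : ∀ a, w.loop a = w'.loop a) : w = w' := by
  obtain ⟨p, a, _, _, _⟩ := w
  obtain ⟨p', a', _, _, _⟩ := w'
  obtain rfl : p = p' := funext h
  obtain rfl : a = a' := funext h'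
  rfl

theorem sectorState_injective [Nontrivial V] (hG : G.Connected) :
    Function.Injective fun w : StrongConfig l => sectorState m w := by
  intro w w' h
  have hP : projector m w = projector m w' :=
    smul_right_injective _ (inv_ne_zero sectorDim_ne_zero) h
  refine StrongConfig.ext (fun p => ?_) fun a => ?_
  · refine smul_left_injective ℂ (projector_ne_zero m w hG) ?_
    dsimp only
    rw [← W_plaq_mul_projector, hP, W_plaq_mul_projector]
  · refine smul_left_injective ℂ (projector_ne_zero m w hG) ?_
    dsimp only
    rw [← W_loop_mul_projector, hP, W_loop_mul_projector]

end Sector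

/-! ### The number of flux configurations -/

section Count

variable {s : SurfaceEmbedding G} {l : s.LoopSystem}

theorem sum_length_faceWalk (r : RotationSystem G) [Fintype r.Face] :
    ∑ f, (r.faceWalk f).length = 2 * G.edgeFinset.card := by
  have h : ∀ f, (r.faceWalk f).length = ((r.faceWalk f).darts.map fun _ => 1).sum := fun f => by
    simp
  rw [Finset.sum_congr rfl fun f _ => h f, r.sum_sum_faceWalk_darts,
    ← G.dart_card_eq_twice_card_edges]
  simp

/-- Restriction of a flux configuration to the plaquettes in `Q` and the loops. -/
def StrongConfig.restrict (Q : Finset s.Plaquette) (w : StrongConfig l) :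
    ∀ i, fluxValues (strongWalk l Q i).2.length :=
  fun i => ⟨w.value Q i, w.value_mem Q i⟩

theorem StrongConfig.restrict_bijective {Q : Finset s.Plaquette}
    (hQ : Q.card + s.b₂ = Fintype.card s.Plaquette) :
    Function.Bijective (StrongConfig.restrict (l := l) Q) := by
  classical
  constructor
  · intro w w' h
    have hv : ∀ i, w.value Q i = w'.value Q i := fun i => congrArg Subtype.val (congrFun h i)
    have hl : ∀ a, w.loop a = w'.loop a := fun a => hv (Sum.inr a)
    have hp : ∀ p ∈ Q, w.plaq p = w'.plaq p := fun p hp => hv (Sum.inl ⟨p, hp⟩)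
    refine StrongConfig.ext (fun p => ?_) hl
    rcases plaquettes_cases hQ with ⟨-, h⟩ | ⟨h, p₀, hp₀, hQ'⟩
    · exact hp p (h p)
    · by_cases hpp : p = p₀
      · subst hpp
        have h1 := (w.total h).trans (w'.total h).symm
        rw [← Finset.mul_prod_erase univ _ (Finset.mem_univ p),
          ← Finset.mul_prod_erase univ w'.plaq (Finset.mem_univ p),
          Finset.prod_congr rfl fun q hq => hp q (hQ' q (Finset.ne_of_mem_erase hq))] at h1
        refine mul_right_cancel₀ ?_ h1
        exact Finset.prod_ne_zero_iff.2 fun q _ => ne_zero_of_mem_fluxValues (w'.plaq_mem q)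
      · exact hp p (hQ' p hpp)
  · intro f
    rcases plaquettes_cases hQ with ⟨hne, h⟩ | ⟨h, p₀, hp₀, hQ'⟩
    · refine ⟨⟨fun p => f (Sum.inl ⟨p, h p⟩), fun a => f (Sum.inr a), fun p => (f (Sum.inl ⟨p, h p⟩)).2,
        fun a => (f (Sum.inr a)).2, fun h => absurd h hne.ne_empty⟩, ?_⟩
      funext i
      rcases i with i | i <;> rfl
    · have : Fintype s.Face := Fintype.ofFinite _
      let c : ℂ := ∏ p : {p // p ∈ Q}, (f (Sum.inl p) : ℂ)
      have hc0 : c ≠ 0 := Finset.prod_ne_zero_iff.2 fun p _ => ne_zero_of_mem_fluxValues (f _).2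
      have huniv : (univ : Finset s.Plaquette) = insert p₀ Q := by
        ext p
        by_cases hp : p = p₀
        · simp [hp]
        · simp [hQ' p hp]
      have hlen : (s.faceWalk p₀.1).length +
          ∑ p : {p // p ∈ Q}, (s.faceWalk p.1.1).length = 2 * G.edgeFinset.card := by
        rw [← sum_length_faceWalk s.toRotationSystem,
          Finset.sum_coe_sort Q fun p => (s.faceWalk p.1).length, 
          ← Finset.sum_insert (f := fun p : s.Plaquette => (s.faceWalk p.1).length) hp₀, ← huniv]
        exact Fintype.sum_equiv (Equiv.subtypeUnivEquiv fun f => by simp [h]) _ _ fun _ => rfl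
      have hcmem : c⁻¹ ∈ fluxValues (s.faceWalk p₀.1).length := by
        have hsq : c * c = (-1) ^ ∑ p : {p // p ∈ Q}, (s.faceWalk p.1.1).length := by
          rw [← Finset.prod_mul_distrib, ← Finset.prod_pow_eq_pow_sum]
          exact Finset.prod_congr rfl fun p _ => mem_fluxValues_iff.1 (f (Sum.inl p)).2
        rw [mem_fluxValues_iff, ← mul_inv, hsq]
        refine inv_eq_of_mul_eq_one_left ?_
        rw [← pow_add, hlen, pow_mul]
        simp
      refine ⟨⟨fun p => if hp : p ∈ Q then f (Sum.inl ⟨p, hp⟩) else c⁻¹, fun a => f (Sum.inr a),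
        fun p => ?_, fun a => (f (Sum.inr a)).2, fun _ => ?_⟩, ?_⟩
      · split_ifs with hp
        · exact (f (Sum.inl ⟨p, hp⟩)).2
        · obtain rfl : p = p₀ := by_contra fun h => hp (hQ' p h)
          exact hcmem
      · rw [huniv, Finset.prod_insert hp₀, dif_neg hp₀, ← Finset.prod_coe_sort Q]
        rw [Finset.prod_congr rfl fun p _ => dif_pos p.2]
        exact inv_mul_cancel₀ hc0
      · funext i
        rcases i with i | i
        · exact Subtype.ext (dif_pos i.2)
        · rfl

theorem card_strongConfig [Nontrivial V] (hG : G.Connected) :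
    Nat.card (StrongConfig l) = 2 ^ (G.edgeFinset.card + 1 - Fintype.card V) := by
  obtain ⟨Q, hQ⟩ := exists_plaquettes hG s
  rw [Nat.card_congr (Equiv.ofBijective _ (StrongConfig.restrict_bijective hQ)), Nat.card_pi]
  simp only [card_fluxValues, Finset.prod_const, Finset.card_univ]
  congr 1
  have := card_strong hG hQ
  omega

theorem sectorState_of_even (m : Model G) (w : StrongConfig l) (h : ∀ v, Even (G.degree v)) :
    sectorState m w = (2 ^ (Fintype.card V - 1) : ℂ)⁻¹ • projector m w := by
  have h0 : #{v : V | Odd (G.degree v)} = 0 := by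
    rw [Finset.card_eq_zero, Finset.filter_eq_empty_iff]
    exact fun v _ => Nat.not_odd_iff_even.2 (h v)
  simp [sectorState, sectorDim, h0]

end Count

end

end GammaLindblad

end

open GammaLindblad in
theorem mainTheorem4 {V : Type*} [Fintype V] [DecidableEq V] [Nontrivial V]
    (G : SimpleGraph V) [DecidableRel G.Adj] (hG : G.Connected) (m : Model G) :
    -- closed strings are strong symmetries, open chiral strings are weak symmetries
    (∀ (u : V) (C : G.Walk u u), IsStrongSymmetry m.H m.jump (m.W C)) ∧
    (∀ (u v : V) (P : G.Walk u v), u ≠ v → IsWeakSymmetry m.H m.jump (m.Wch P)) ∧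
    ∀ s : SurfaceEmbedding G, Nonempty s.LoopSystem ∧ ∀ l : s.LoopSystem,
      -- the elementary fluxes, with one plaquette omitted if the surface is closed
      (∀ Q : Finset s.Plaquette, Q.card + s.b₂ = Fintype.card s.Plaquette →
        ∀ o : G.edgeSet → G.Dart, (∀ e, (o e).edge = e) →
        -- they are conserved and commute with each other
        (∀ i ρ, lindbladian m.H m.jump (elementaryFlux m l Q o i ρ) =
          elementaryFlux m l Q o i (lindbladian m.H m.jump ρ)) ∧
        (∀ i j, Commute (elementaryFlux m l Q o i) (elementaryFlux m l Q o j)) ∧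
        -- they are independent
        IsIndependent (elementaryFlux m l Q o) ∧
        -- they generate all the fluxes
        (∀ (u : V) (C : G.Walk u u), IsGeneratedBy (strongFlux m l Q) (m.W C)) ∧
        (∀ (u : V) (C : G.Walk u u),
          IsGeneratedBy (elementaryFlux m l Q o) (rightAction (m.W C))) ∧
        (∀ (u v : V) (P : G.Walk u v), u ≠ v →
          IsGeneratedBy (fun e => m.interlayerFlux (o e)) (adjointAction (m.Wch P))) ∧
        -- their numbers: strong, weak and in total
        (Fintype.card ({p // p ∈ Q} ⊕ Fin s.b₁) : ℤ) =
          (G.edgeFinset.card : ℤ) - Fintype.card V + 1 ∧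
        Fintype.card G.edgeSet = G.edgeFinset.card ∧
        (Fintype.card (({p // p ∈ Q} ⊕ Fin s.b₁) ⊕ G.edgeSet) : ℤ) =
          2 * (G.edgeFinset.card : ℤ) - Fintype.card V + 1) ∧
      -- the strong-flux configurations and their steady states
      Nat.card (StrongConfig l) = 2 ^ (G.edgeFinset.card + 1 - Fintype.card V) ∧
      Function.Injective (fun w : StrongConfig l => sectorState m w) ∧
      (∀ w : StrongConfig l,
        -- `P_w` is the orthogonal projector onto the sector `w`, of dimension `𝒵`
        IsStarProjection (projector m w) ∧
        (∀ x : Basis G → ℂ, projector m w *ᵥ x = x ↔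
          (∀ p, m.W (s.faceWalk p.1) *ᵥ x = w.plaq p • x) ∧
          (∀ a, m.W (l.loop a) *ᵥ x = w.loop a • x)) ∧
        (projector m w).trace = sectorDim G ∧
        -- `P_w / 𝒵` is a steady state, in the sector `w` with trivial interlayer fluxes
        IsSteadyState m.H m.jump (sectorState m w) ∧
        (∀ d : G.Dart, m.interlayerFlux d (sectorState m w) = sectorState m w) ∧
        -- the normalization by `2 ^ (N - 1)`
        lindbladian m.H m.jump ((2 ^ (Fintype.card V - 1) : ℂ)⁻¹ • projector m w) = 0 ∧
        ((∀ v, Even (G.degree v)) →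
          sectorState m w = (2 ^ (Fintype.card V - 1) : ℂ)⁻¹ • projector m w)) := by
  refine ⟨fun u C => m.W_isStrongSymmetry C, fun u v P _ => m.Wch_isWeakSymmetry P, fun s =>
    ⟨SurfaceEmbedding.nonempty_loopSystem hG s, fun l => ⟨fun Q hQ o ho => ?_,
      card_strongConfig hG, sectorState_injective m hG, fun w => ?_⟩⟩⟩
  · have hcard := card_strong hG hQ
    refine ⟨lindbladian_elementaryFlux m l Q o, elementaryFlux_commute m l Q o,
      elementaryFlux_isIndependent m l hG hQ ho, fun u C => strongFlux_generates m l hG hQ C,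
      fun u C => (generated_rightAction m l hG hQ ho C).isGeneratedBy, fun u v P _ => ?_,
      by omega, (SimpleGraph.edgeFinset_card).symm, ?_⟩
    · exact (m.generated_adjointAction_Wch (m.interlayerFlux_projInvolutive o) ho
        (fun e => generated_self (Φ := fun e => m.interlayerFlux (o e)) e) P).isGeneratedBy
    · rw [Fintype.card_sum, ← SimpleGraph.edgeFinset_card]
      push_cast
      omega
  · refine ⟨projector_isStarProjection m w, projector_mulVec_eq_iff m w, trace_projector m w hG,
      sectorState_isSteadyState m w hG, interlayerFlux_sectorState m w, ?_,
      sectorState_of_even m w⟩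
    rw [lindbladian_smul, lindbladian_projector, smul_zero]
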